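/- Let $p$ be a prime, $m\ge 1$ and $k\ge 2$ integers, and put $R=\mathbb F_p[u]/(u^k)$, $\mathcal R=\mathbb F_{p^m}[u]/(u^k)$ and $Tr:\mathcal R\to R$, $Tr\big(\sum_{i<k}a_iu^i\big)=\sum_{i<k}tr(a_i)u^i$, where $tr$ is the trace of $\mathbb F_{p^m}$ over $\mathbb F_p$. The homogeneous weight on $R$ is $w(0)=0$, $w(x)=p^{k-1}$ for $x\in(u^{k-1})\setminus\{0\}$ and $w(x)=(p-1)p^{k-2}$ for $x\notin(u^{k-1})$; the weight of a word over $R$ is the sum of the weights of its coordinates. Let $\alpha$ be a primitive element of $\mathbb F_{p^m}$, let $N'$ be a positive divisor of $p^m-1$, and put $N'_1=\mathrm{lcm}\big(N',\frac{p^m-1}{p-1}\big)$, $N'_2=\gcd\big(N',\frac{p^m-1}{p-1}\big)$, $n_1=N'_1/N'$ and $D'=\{\alpha^{N'(j-1)}:1\le j\le n_1\}$. Let $D_3=\{x_0+x_1u+\dots+x_{k-1}u^{k-1}: x_0\in D',\ x_1,\dots,x_{k-1}\in\mathbb F_{p^m}\}$ and $C_{D_3}=\{(Tr(xd))_{d\in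 D_3}:x\in\mathcal R\}$. **Theorem.** Let $m$ be even and $N'_2>2$. Assume that $k'$ is a positive integer with $p^{k'}\equiv-1\pmod{N'_2}$ such that $t=\frac{m}{2k'}$ is an integer. (i) Suppose that $N'_2$ is even and that $p$, $t$ and $\frac{p^{k'}+1}{N'_2}$ are odd. If $N'_2<p^{m/2}+1$, then $C_{D_3}$ is a linear code over $R$ with exactly three nonzero homogeneous weights, and its weight distribution is: - weight $0$, with frequency $1$; - weight $p^{(k-1)(m+1)-1}\cdot\frac{p^m-(N'_2-1)p^{m/2}}{N'_2}$, with frequency $\frac{p^m-1}{N'_2}$; - weight $p^{(k-1)(m+1)-1}\cdot\frac{p^m-1}{N'_2}$, with frequency $p^{km}-p^m$; - weight $p^{(k-1)(m+1)-1}\cdot\frac{p^m+p^{m/2}}{N'_2}$, with frequency $\frac{(N'_2-1)(p^m-1)}{N'_2}$. (ii) In all other cases, if $p^{m/2}+(-1)^t(N'_2-1)>0$, then $C_{D_3}$ is a linear code over $R$ with exactly three nonzero homogeneous weights, and its weight distribution is: - weight $0$, with frequency $1$; - weight $p^{(k-1)(m+1)-1}\cdot\frac{p^m+(-1)^t(N'_2-1)p^{m/2}}{N'_2}$,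 with frequency $\frac{p^m-1}{N'_2}$; - weight $p^{(k-1)(m+1)-1}\cdot\frac{p^m-1}{N'_2}$, with frequency $p^{km}-p^m$; - weight $p^{(k-1)(m+1)-1}\cdot\frac{p^m-(-1)^tp^{m/2}}{N'_2}$, with frequency $\frac{(N'_2-1)(p^m-1)}{N'_2}$. -/

import Mathlib

open Polynomial

namespace FewWeights

/-- The chain ring `F + uF + ⋯ + u^(k-1)F` with `u^k = 0`, i.e. `F[X]/(X^k)`;
`u` is `AdjoinRoot.root (X ^ k)`. -/
abbrev ChainRing (F : Type*) [Field F] (k : ℕ) : Type _ := AdjoinRoot (X ^ k : F[X])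

/-- The element `u`. -/
noncomputable def uElt (F : Type*) [Field F] (k : ℕ) : ChainRing F k :=
  AdjoinRoot.root (X ^ k : F[X])

/-- The coefficient `a_i` of `a = a_0 + a_1 u + ⋯ + a_(k-1) u^(k-1)`
(and `0` when `i ≥ k`). -/
noncomputable def uCoeff {F : Type*} [Field F] {k : ℕ} (a : ChainRing F k) (i : ℕ) : F :=
  (AdjoinRoot.modByMonicHom (monic_X_pow k : (X ^ k : F[X]).Monic) a).coeff i

instance finite_chainRing (F : Type*) [Field F] [Finite F] (k : ℕ) : Finite (ChainRing F k) :=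
  haveI : Module.Finite F (ChainRing F k) := (monic_X_pow k : (X ^ k : F[X]).Monic).finite_adjoinRoot
  Module.finite_of_finite F

/-- The generalized trace `Tr(∑ a_i u^i) = ∑ tr(a_i) u^i` from `F + uF + ⋯ + u^(k-1)F` down to
`𝔽_p + u𝔽_p + ⋯ + u^(k-1)𝔽_p`, where `tr` is the trace of `F` over `𝔽_p`. -/
noncomputable def genTrace (p : ℕ) [Fact p.Prime] {F : Type*} [Field F] [Algebra (ZMod p) F]
    {k : ℕ} (a : ChainRing F k) : ChainRing (ZMod p) k :=
  ∑ i ∈ Finset.range k,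
    algebraMap (ZMod p) (ChainRing (ZMod p) k) (Algebra.trace (ZMod p) F (uCoeff a i)) *
      uElt (ZMod p) k ^ i

open Classical in
/-- The homogeneous weight on `R = 𝔽_p + u𝔽_p + ⋯ + u^(k-1)𝔽_p` (for `k ≥ 2`). -/
noncomputable def homWeight {p : ℕ} [Fact p.Prime] {k : ℕ} (x : ChainRing (ZMod p) k) : ℕ :=
  if x = 0 then 0
  else if x ∈ Ideal.span {uElt (ZMod p) k ^ (k - 1)} then p ^ (k - 1)
  else (p - 1) * p ^ (k - 2)

/-- The homogeneous weight of a word over `R` with coordinates indexed by a finite type: the sum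
of the weights of its coordinates. -/
noncomputable def wordWeight {p : ℕ} [Fact p.Prime] {k : ℕ} {ι : Type*} [Finite ι]
    (c : ι → ChainRing (ZMod p) k) : ℕ :=
  ∑ᶠ i, homWeight (c i)

/-- The trace code `C_D = {(Tr(xd))_{d ∈ D} : x}` with defining set `D`. -/
def traceCode (p : ℕ) [Fact p.Prime] {F : Type*} [Field F] [Algebra (ZMod p) F] {k : ℕ}
    (D : Set (ChainRing F k)) : Set (D → ChainRing (ZMod p) k) :=
  {c | ∃ x : ChainRing F k, c = fun d : D => genTrace p (x * d.1)}

/-- A code over `R` is linear if it is an `R`-submodule of the space of words. -/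
def IsLinearCode {R : Type*} [CommRing R] {ι : Type*} (C : Set (ι → R)) : Prop :=
  ∃ S : Submodule R (ι → R), (S : Set (ι → R)) = C

/-- A three-weight code: the nonzero codewords take exactly three homogeneous weights, all of
them nonzero. -/
def IsThreeWeight {p : ℕ} [Fact p.Prime] {k : ℕ} {ι : Type*} [Finite ι]
    (C : Set (ι → ChainRing (ZMod p) k)) : Prop :=
  {w : ℕ | ∃ c ∈ C, c ≠ 0 ∧ wordWeight c = w}.ncard = 3 ∧ ∀ c ∈ C, c ≠ 0 → wordWeight c ≠ 0

/-- The list `T` of pairs (weight, frequency) is the weight distribution of `C`: the listed weights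
are distinct, every codeword has a listed weight, and for each listed pair `(w, f)` the number of
codewords of weight `w` is `f`. -/
def HasWeightDistribution {p : ℕ} [Fact p.Prime] {k : ℕ} {ι : Type*} [Finite ι]
    (C : Set (ι → ChainRing (ZMod p) k)) (T : List (ℚ × ℚ)) : Prop :=
  (T.map Prod.fst).Nodup ∧
  (∀ c ∈ C, (wordWeight c : ℚ) ∈ T.map Prod.fst) ∧
  ∀ wf ∈ T, ({c | c ∈ C ∧ (wordWeight c : ℚ) = wf.1}.ncard : ℚ) = wf.2

/-- `N'_1 = lcm(N', (p^m - 1)/(p - 1))`. -/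
def lcmN (p m N : ℕ) : ℕ := Nat.lcm N ((p ^ m - 1) / (p - 1))

/-- `N'_2 = gcd(N', (p^m - 1)/(p - 1))`. -/
def gcdN (p m N : ℕ) : ℕ := Nat.gcd N ((p ^ m - 1) / (p - 1))

/-- `D' = {α^(N'(j-1)) : j = 1, …, n_1}` with `n_1 = N'_1 / N'`. -/
def baseSet (p m N : ℕ) {F : Type*} [Field F] (α : F) : Set F :=
  {y | ∃ j : ℕ, 1 ≤ j ∧ j ≤ lcmN p m N / N ∧ y = α ^ (N * (j - 1))}

/-- The defining set `D_3 = D' + uF + ⋯ + u^(k-1)F`. -/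
def definingSet₃ (p m N : ℕ) {F : Type*} [Field F] (α : F) (k : ℕ) : Set (ChainRing F k) :=
  {x | uCoeff x 0 ∈ baseSet p m N α}

/-- The weight distribution of the first case, with `n` standing for `N'_2`. -/
def distributionA (p m k n : ℕ) : List (ℚ × ℚ) :=
  [(0, 1),
   ((p : ℚ) ^ ((k - 1) * (m + 1) - 1) * (((p : ℚ) ^ m - ((n : ℚ) - 1) * (p : ℚ) ^ (m / 2)) / n),
     ((p : ℚ) ^ m - 1) / n),
   ((p : ℚ) ^ ((k - 1) * (m + 1) - 1) * (((p : ℚ) ^ m - 1) / n),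
     (p : ℚ) ^ (k * m) - (p : ℚ) ^ m),
   ((p : ℚ) ^ ((k - 1) * (m + 1) - 1) * (((p : ℚ) ^ m + (p : ℚ) ^ (m / 2)) / n),
     ((n : ℚ) - 1) * ((p : ℚ) ^ m - 1) / n)]

/-- The weight distribution of the second case, with `n` standing for `N'_2`. -/
def distributionB (p m k n t : ℕ) : List (ℚ × ℚ) :=
  [(0, 1),
   ((p : ℚ) ^ ((k - 1) * (m + 1) - 1) *
       (((p : ℚ) ^ m + (-1) ^ t * ((n : ℚ) - 1) * (p : ℚ) ^ (m / 2)) / n),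
     ((p : ℚ) ^ m - 1) / n),
   ((p : ℚ) ^ ((k - 1) * (m + 1) - 1) * (((p : ℚ) ^ m - 1) / n),
     (p : ℚ) ^ (k * m) - (p : ℚ) ^ m),
   ((p : ℚ) ^ ((k - 1) * (m + 1) - 1) * (((p : ℚ) ^ m - (-1) ^ t * (p : ℚ) ^ (m / 2)) / n),
     ((n : ℚ) - 1) * ((p : ℚ) ^ m - 1) / n)]

end FewWeights

/-! Write `q = p^m`, `n = N'_2`, and let `x` be a parameter in the chain ring over `F`.

If `x` is outside `(u^(k-1))`, let `x_j` be its first nonzero coefficient, so `j < k-1`. Adding a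
multiple of `u^(k-1-j)` to `d` keeps `d` in `D_3` and changes only the top coefficient of `xd`.
Hence the values `Tr(xd)` lying in the minimal ideal `(u^(k-1))` are equidistributed there. The
homogeneous weight has average `(p-1)p^(k-2)` over that ideal and is equal to this number outside
it, so all these `x` give one weight.

If `x = a u^(k-1)`, then `Tr(xd) = tr(a d_0) u^(k-1)`, and the weight is governed by the number of
`y` in `D'` with `tr(ay) ≠ 0`. The set `D'` represents the `n`-th powers of `F` modulo scalars of
`𝔽_p`, so this number is expressed by the power sum `S_n(a) = ∑ z, ψ(a z^n)`
(`mul_card_baseSet_filter_eq_sub_powSum`).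

The power sum is evaluated without Gauss sums. Let `Q = p^k'` and `Q + 1 = nl`. The square of
`S_(Q+1)(b)` is `q` times the number of zeros of a linearized polynomial, which is `1` or `Q^2`; the
congruence `S_(Q+1)(b) ≡ 1` mod `Q + 1` fixes the sign. Averaging `S_(nl)(a z^n)` over `z ≠ 0`
returns `S_n(a)` (`powSum_semiprimitive`). One coset of size `(q-1)/n` takes the exceptional value,
and counting parameters gives the frequencies. -/

namespace FewWeights

/-! ### Power sums of the canonical character: integrality and a congruence -/

section FiniteField

open Finset Classical

section Trace

variable {F : Type*} [Field F] (p : ℕ) [Fact p.Prime] [Algebra (ZMod p) F]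

/-- The canonical additive character `x ↦ exp(2πi tr(x)/p)` of `F`. -/
noncomputable def traceChar : AddChar F ℂ :=
  (ZMod.stdAddChar (N := p)).compAddMonoidHom (Algebra.trace (ZMod p) F).toAddMonoidHom

theorem trace_algebraMap_mul (c : ZMod p) (x : F) :
    Algebra.trace (ZMod p) F (algebraMap (ZMod p) F c * x) = c * Algebra.trace (ZMod p) F x := by
  rw [← Algebra.smul_def, map_smul, smul_eq_mul]

theorem exists_algebraMap_eq_of_pow_eq_self {x : F} (hx : x ^ p = x) :
    ∃ c : ZMod p, algebraMap (ZMod p) F c = x := by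
  have : CharP F p := charP_of_injective_algebraMap (algebraMap (ZMod p) F).injective p
  obtain ⟨n, hn⟩ := (_root_.mem_bot_iff_intCast p F).mp
    ((_root_.Subfield.mem_bot_iff_pow_eq_self F p).mpr hx)
  exact ⟨n, by simpa using hn⟩

theorem traceChar_apply (x : F) :
    traceChar p x = ZMod.stdAddChar (Algebra.trace (ZMod p) F x) := rfl

end Trace

variable {F : Type*} [Field F] [Fintype F]

theorem exists_isPrimitiveRoot_card_sub_one : ∃ g : F, IsPrimitiveRoot g (Fintype.card F - 1) ∧
    ∀ c : F, c ≠ 0 → ∃ i : ℕ, g ^ i = c := by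
  obtain ⟨g, hg⟩ := IsCyclic.exists_generator (α := Fˣ)
  refine ⟨g, ?_, fun c hc => ?_⟩
  · rw [IsPrimitiveRoot.coe_units_iff, ← Fintype.card_units, ← Nat.card_eq_fintype_card,
      ← orderOf_eq_card_of_forall_mem_zpowers hg]
    exact IsPrimitiveRoot.orderOf g
  · obtain ⟨i, hi⟩ := (mem_powers_iff_mem_zpowers.mpr (hg (Units.mk0 c hc)))
    exact ⟨i, by simpa using congrArg Units.val hi⟩

theorem card_filter_pow_eq {d e : ℕ} (h : Fintype.card F = d * e + 1) {c : F} (hc : c ≠ 0) :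
    #{z : F | z ^ d = c} = if c ^ e = 1 then d else 0 := by
  obtain ⟨g, hg, hgen⟩ := exists_isPrimitiveRoot_card_sub_one (F := F)
  have hcard := Fintype.one_lt_card (α := F)
  have hde : 0 < d * e := by omega
  have hd : 0 < d := Nat.pos_of_mul_pos_right hde
  have he : 0 < e := Nat.pos_of_mul_pos_left hde
  rw [h, Nat.add_sub_cancel] at hg
  have hζ : IsPrimitiveRoot (g ^ e) d := hg.pow hde (mul_comm d e)
  have hset : ({z : F | z ^ d = c} : Finset F) = (nthRoots d c).toFinset := by
    ext z; simp [mem_nthRoots hd]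
  rw [hset, Multiset.toFinset_card_of_nodup (hζ.nthRoots_nodup hc), hζ.card_nthRoots]
  congr 1
  refine propext ⟨?_, fun hce => ?_⟩
  · rintro ⟨z, rfl⟩
    have hz : z ≠ 0 := by rintro rfl; simp [hd.ne'] at hc
    rw [← pow_mul]
    have := FiniteField.pow_card_sub_one_eq_one z hz
    rwa [h, Nat.add_sub_cancel] at this
  · obtain ⟨i, rfl⟩ := hgen c hc
    rw [← pow_mul, hg.pow_eq_one_iff_dvd] at hce
    obtain ⟨j, rfl⟩ := Nat.dvd_of_mul_dvd_mul_right he hce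
    exact ⟨g ^ j, by rw [← pow_mul, mul_comm]⟩

theorem pow_mul_eq_one {d e : ℕ} (h : Fintype.card F = d * e + 1) {z : F} (hz : z ≠ 0) :
    z ^ (d * e) = 1 := by
  have := FiniteField.pow_card_sub_one_eq_one z hz
  rwa [h, Nat.add_sub_cancel] at this

theorem exists_pow_eq {d e : ℕ} (h : Fintype.card F = d * e + 1) {c : F} (hc : c ≠ 0)
    (hce : c ^ e = 1) : ∃ z : F, z ^ d = c := by
  have hd : 0 < d := by
    have hcard := Fintype.one_lt_card (α := F)
    exact Nat.pos_of_mul_pos_right (b := e) (by omega)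
  have := card_filter_pow_eq h hc
  rw [if_pos hce] at this
  obtain ⟨z, hz⟩ := card_pos.mp (this ▸ hd)
  exact ⟨z, by simpa using hz⟩

/-- The set is a union of nonempty fibres of `z ↦ z^d` on nonzero elements, each of size `d`. -/
theorem dvd_card_filter {d e : ℕ} (h : Fintype.card F = d * e + 1) (P : F → Prop)
    (hP : ∀ z w, z ^ d = w ^ d → P z → P w) : d ∣ #{z : F | z ≠ 0 ∧ P z} := by
  rw [card_eq_sum_card_image (fun z => z ^ d)]
  refine dvd_sum fun y hy => ?_
  obtain ⟨w, hw, rfl⟩ := mem_image.mp hy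
  obtain ⟨hw0, hPw⟩ : w ≠ 0 ∧ P w := by simpa using hw
  have : ({z ∈ ({z : F | z ≠ 0 ∧ P z} : Finset F) | z ^ d = w ^ d}) =
      ({z : F | z ^ d = w ^ d} : Finset F) := by
    ext z
    simp only [mem_filter, mem_univ, true_and, and_iff_right_iff_imp]
    refine fun hz => ⟨?_, hP w z hz.symm hPw⟩
    rintro rfl
    have hd : d ≠ 0 := by
      rintro rfl
      have hcard := Fintype.one_lt_card (α := F)
      omega
    rw [zero_pow hd] at hz
    exact pow_ne_zero d hw0 hz.symm
  simp only [this]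
  rw [card_filter_pow_eq h (pow_ne_zero d hw0), ← pow_mul, pow_mul_eq_one h hw0, if_pos rfl]

variable (p : ℕ) [Fact p.Prime] [Algebra (ZMod p) F]

theorem trace_zmod_surjective : Function.Surjective (Algebra.trace (ZMod p) F) :=
  Algebra.trace_surjective _ _

theorem traceChar_isPrimitive : (traceChar p : AddChar F ℂ).IsPrimitive := by
  refine AddChar.IsPrimitive.of_ne_one fun h => ?_
  obtain ⟨x, hx⟩ := trace_zmod_surjective (F := F) p 1
  have h1 : traceChar p x = 1 := by rw [h]; rfl
  rw [traceChar_apply, hx, ← AddChar.map_zero_eq_one (ZMod.stdAddChar (N := p))] at h1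
  exact one_ne_zero (ZMod.injective_stdAddChar h1)

theorem sum_traceChar_mul (a : F) :
    ∑ x : F, traceChar p (x * a) = if a = 0 then (Fintype.card F : ℂ) else 0 := by
  rw [AddChar.sum_mulShift a (traceChar_isPrimitive p)]
  split_ifs <;> simp

theorem trace_pow_char (x : F) :
    Algebra.trace (ZMod p) F (x ^ p) = Algebra.trace (ZMod p) F x := by
  have := Algebra.trace_eq_of_algEquiv (FiniteField.frobeniusAlgEquivOfAlgebraic (ZMod p) F) x
  simpa [ZMod.card] using this

theorem trace_pow_char_pow (j : ℕ) (x : F) :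
    Algebra.trace (ZMod p) F (x ^ p ^ j) = Algebra.trace (ZMod p) F x := by
  induction j with
  | zero => simp
  | succ j ih => rw [pow_succ, pow_mul, trace_pow_char, ih]

/-- The trace is a sum of `2jt` Frobenius conjugates. Raising to the power `p^j` changes the sign,
so consecutive blocks of `j` conjugates cancel in pairs. -/
theorem trace_eq_zero_of_pow_eq_neg {j t : ℕ} (hF : Fintype.card F = p ^ (2 * j * t)) {y : F}
    (hy : y ^ p ^ j = -y) : Algebra.trace (ZMod p) F y = 0 := by
  have hp : p.Prime := Fact.out
  have : CharP F p := charP_of_injective_algebraMap (algebraMap (ZMod p) F).injective p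
  have hrank : Module.finrank (ZMod p) F = 2 * j * t := by
    have := Module.card_eq_pow_finrank (K := ZMod p) (V := F)
    rw [hF, ZMod.card] at this
    exact (Nat.pow_right_injective hp.two_le this).symm
  apply (algebraMap (ZMod p) F).injective
  rw [FiniteField.algebraMap_trace_eq_sum_pow, hrank, map_zero, Nat.card_zmod]
  have hshift : ∀ i, y ^ p ^ (j + i) = - y ^ p ^ i := fun i => by
    rw [pow_add, pow_mul, hy]
    have := map_neg (iterateFrobenius F p i) y
    simpa [iterateFrobenius_def] using this
  clear hrank hF
  induction t with
  | zero => simp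
  | succ t ih =>
    rw [show 2 * j * (t + 1) = 2 * j * t + j + j by ring, sum_range_add, sum_range_add, ih]
    have : ∀ i, y ^ p ^ (2 * j * t + j + i) = - y ^ p ^ (2 * j * t + i) := fun i => by
      rw [← hshift]; congr 2; ring
    simp [this]

/-- The sum `∑ z, ψ(a z^d)` over `F`, with `ψ` the canonical additive character. -/
noncomputable def powSum (d : ℕ) (a : F) : ℂ := ∑ z : F, traceChar p (a * z ^ d)

/-- Summing over `c * a` with `c` in `𝔽_p` detects vanishing of the trace. Since `d` divides
`(q-1)/(p-1)`, every nonzero `c` is a `d`-th power, so its term is the same as for `c = 1`. -/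
theorem card_add_mul_powSum {d e : ℕ} (h : Fintype.card F = d * ((p - 1) * e) + 1) (a : F) :
    (Fintype.card F : ℂ) + (p - 1) * powSum p d a =
      p * #{z : F | Algebra.trace (ZMod p) F (a * z ^ d) = 0} := by
  have hp : p.Prime := Fact.out
  have key : ∑ c : ZMod p, powSum p d (algebraMap (ZMod p) F c * a) =
      p * #{z : F | Algebra.trace (ZMod p) F (a * z ^ d) = 0} := by
    simp only [powSum]
    rw [sum_comm]
    have : ∀ z : F, ∑ c : ZMod p, traceChar p (algebraMap (ZMod p) F c * a * z ^ d) =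
        if Algebra.trace (ZMod p) F (a * z ^ d) = 0 then (p : ℂ) else 0 := fun z => by
      have := AddChar.sum_mulShift (Algebra.trace (ZMod p) F (a * z ^ d))
        (ZMod.isPrimitive_stdAddChar p)
      rw [ZMod.card] at this
      simp only [traceChar_apply, mul_assoc, trace_algebraMap_mul]
      rw [this]
      split_ifs <;> simp
    simp only [this]
    rw [← sum_filter, sum_const, nsmul_eq_mul, mul_comm]
  rw [← key, ← add_sum_erase univ _ (mem_univ (0 : ZMod p))]
  have : ∀ c ∈ univ.erase (0 : ZMod p),
      powSum p d (algebraMap (ZMod p) F c * a) = powSum p d a := fun c hc => by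
    have hc0 : algebraMap (ZMod p) F c ≠ 0 := by simpa using hc
    have hc1 : (algebraMap (ZMod p) F c) ^ ((p - 1) * e) = 1 := by
      rw [pow_mul, ← map_pow, ZMod.pow_card_sub_one_eq_one (by simpa using hc)]
      simp
    obtain ⟨w, hw⟩ := exists_pow_eq h hc0 hc1
    have hw0 : w ≠ 0 := by
      rintro rfl
      have hd : d ≠ 0 := by
        rintro rfl
        have hcard := Fintype.one_lt_card (α := F)
        omega
      exact hc0 (by rw [← hw, zero_pow hd])
    simp only [powSum]
    rw [← Equiv.sum_comp (Equiv.mulLeft₀ w hw0) (fun z => traceChar p (a * z ^ d))]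
    refine sum_congr rfl fun z _ => ?_
    rw [← hw]
    congr 1
    simp only [Equiv.mulLeft₀_apply, mul_pow]
    ring
  rw [sum_congr rfl this, sum_const, card_erase_of_mem (mem_univ _), card_univ, ZMod.card,
    nsmul_eq_mul, Nat.cast_sub hp.one_le]
  simp [powSum, traceChar_apply]

/-- Nonzero `z` with vanishing trace come in fibres of size `d`. Nonvanishing of the trace is also
invariant under nonzero scalars of `𝔽_p`, so it depends only on `z^(d(p-1))` and its count is
divisible by `d(p-1)`. The extra factor `p - 1` is what allows division in `card_add_mul_powSum`;
the `1` comes from `z = 0`. -/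
theorem exists_powSum_eq {d e : ℕ} (h : Fintype.card F = d * ((p - 1) * e) + 1) (a : F) :
    ∃ j : ℤ, powSum p d a = 1 + d * j := by
  have hp : p.Prime := Fact.out
  have hd : d ≠ 0 := by
    rintro rfl
    have hcard := Fintype.one_lt_card (α := F)
    omega
  have hp1 : p - 1 ≠ 0 := by have := hp.two_le; omega
  obtain ⟨u, hu⟩ := dvd_card_filter h (fun z : F => Algebra.trace (ZMod p) F (a * z ^ d) = 0)
    (fun z w hzw hz => by rwa [← hzw])
  have h' : Fintype.card F = (d * (p - 1)) * e + 1 := by rw [h]; ring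
  obtain ⟨v, hv⟩ := dvd_card_filter h' (fun z : F => Algebra.trace (ZMod p) F (a * z ^ d) ≠ 0)
    (fun z w hzw hz hw => hz (by
      by_cases hw0 : w = 0
      · subst hw0
        rw [zero_pow (mul_ne_zero hd hp1)] at hzw
        rw [eq_zero_of_pow_eq_zero hzw, zero_pow hd]; simp
      rw [pow_mul, pow_mul] at hzw
      have h1 : (z ^ d / w ^ d) ^ (p - 1) = 1 := by
        rw [div_pow, hzw, div_self (pow_ne_zero _ (pow_ne_zero _ hw0))]
      have h2 : (z ^ d / w ^ d) ^ p = z ^ d / w ^ d := by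
        rw [← Nat.sub_add_cancel hp.one_le, pow_succ, h1, one_mul]
      obtain ⟨c, hc⟩ := exists_algebraMap_eq_of_pow_eq_self p h2
      rw [eq_div_iff (pow_ne_zero _ hw0)] at hc
      rw [← hc, mul_left_comm, trace_algebraMap_mul, hw, mul_zero]))
  have key := card_add_mul_powSum p h a
  have hZ0 : #{z : F | Algebra.trace (ZMod p) F (a * z ^ d) = 0} = d * u + 1 := by
    rw [← hu, ← card_insert_of_notMem (a := (0 : F)) (by simp)]
    congr 1
    ext z
    by_cases hz : z = 0 <;> simp [hz, hd]
  have hZ1 : #{z : F | ¬ Algebra.trace (ZMod p) F (a * z ^ d) = 0} = d * (p - 1) * v := by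
    rw [← hv]
    congr 1
    ext z
    by_cases hz : z = 0 <;> simp [hz, hd]
  have hsum := card_filter_add_card_filter_not (s := (univ : Finset F))
    (fun z => Algebra.trace (ZMod p) F (a * z ^ d) = 0)
  rw [hZ0, hZ1, card_univ] at hsum
  refine ⟨u - v, ?_⟩
  rw [hZ0, ← hsum] at key
  have hpc : (p : ℂ) - 1 ≠ 0 := sub_ne_zero.mpr (by exact_mod_cast hp.ne_one)
  apply mul_left_cancel₀ hpc
  push_cast [Nat.cast_sub hp.one_le] at key ⊢
  linear_combination key

end FiniteField

/-! ### Evaluation of the power sums in the semiprimitive case -/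

section Semiprimitive

open Finset Classical

variable {F : Type*} [Field F] [Fintype F] (p : ℕ) [Fact p.Prime] [Algebra (ZMod p) F]

theorem powSum_neg {d e : ℕ} (h : Fintype.card F = d * ((p - 1) * e) + 1) (a : F) :
    powSum p d (-a) = powSum p d a := by
  have hp : p.Prime := Fact.out
  have hpc : (p : ℂ) - 1 ≠ 0 := sub_ne_zero.mpr (by exact_mod_cast hp.ne_one)
  have h1 := card_add_mul_powSum p h a
  have h2 := card_add_mul_powSum p h (-a)
  simp only [neg_mul, map_neg, neg_eq_zero] at h2
  exact mul_left_cancel₀ hpc (add_left_cancel (h2.trans h1.symm))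

/-- Because `S(b) = S(-b)`, the square is a double sum of `ψ(b(z+w)^(Q+1) - b w^(Q+1))`. After a
Frobenius twist under the trace the cross terms become linear in `w^Q`, so the sum over `w` keeps
only the `z` in the radical. There `(b z^(Q+1))^Q = -b z^(Q+1)`, so the remaining character value is
`1`. -/
theorem powSum_sq {j t e : ℕ} (hF : Fintype.card F = p ^ (2 * j * t))
    (h : Fintype.card F = (p ^ j + 1) * ((p - 1) * e) + 1) (b : F) :
    powSum p (p ^ j + 1) b ^ 2 = (Fintype.card F : ℂ) *
      #{z : F | b ^ p ^ j * z ^ (p ^ j * p ^ j) + b * z = 0} := by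
  have hp : p.Prime := Fact.out
  have : CharP F p := charP_of_injective_algebraMap (algebraMap (ZMod p) F).injective p
  have hfrob : Function.Bijective (fun w : F => w ^ p ^ j) :=
    Finite.injective_iff_bijective.mp (iterateFrobenius F p j).injective
  set Q := p ^ j with hQ
  have hadd : ∀ z w : F, (z + w) ^ Q = z ^ Q + w ^ Q := fun z w => by
    simpa [iterateFrobenius_def] using map_add (iterateFrobenius F p j) z w
  have hexp : ∀ z w : F, traceChar p (b * (z + w) ^ (Q + 1)) * traceChar p (-b * w ^ (Q + 1)) =
      traceChar p (b * z ^ (Q + 1)) *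
        traceChar p (w ^ Q * (b ^ Q * z ^ (Q * Q) + b * z)) := fun z w => by
    have h1 : Algebra.trace (ZMod p) F (w ^ Q * (b ^ Q * z ^ (Q * Q) + b * z)) =
        Algebra.trace (ZMod p) F (b * z ^ Q * w + b * z * w ^ Q) := by
      rw [map_add, ← trace_pow_char_pow p j (b * z ^ Q * w), ← map_add, ← hQ]
      congr 1
      rw [pow_mul]; ring
    rw [traceChar_apply p (w ^ Q * _), h1, ← traceChar_apply, ← AddChar.map_add_eq_mul,
      ← AddChar.map_add_eq_mul]
    congr 1
    rw [pow_succ, hadd]; ring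
  calc powSum p (Q + 1) b ^ 2 = powSum p (Q + 1) b * powSum p (Q + 1) (-b) := by
        rw [powSum_neg p h, sq]
    _ = ∑ w : F, ∑ z : F,
          traceChar p (b * (z + w) ^ (Q + 1)) * traceChar p (-b * w ^ (Q + 1)) := by
        simp only [powSum]
        rw [mul_sum]
        refine sum_congr rfl fun w _ => ?_
        rw [← sum_mul]
        congr 1
        exact (Equiv.sum_comp (Equiv.addRight w) (fun z => traceChar p (b * z ^ (Q + 1)))).symm
    _ = ∑ z : F, traceChar p (b * z ^ (Q + 1)) *
          ∑ w : F, traceChar p (w ^ Q * (b ^ Q * z ^ (Q * Q) + b * z)) := by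
        rw [sum_comm]
        simp only [hexp, mul_sum]
    _ = ∑ z : F, if b ^ Q * z ^ (Q * Q) + b * z = 0 then (Fintype.card F : ℂ) else 0 := by
        refine sum_congr rfl fun z _ => ?_
        have : ∑ w : F, traceChar p (w ^ Q * (b ^ Q * z ^ (Q * Q) + b * z)) =
            ∑ w : F, traceChar p (w * (b ^ Q * z ^ (Q * Q) + b * z)) :=
          hfrob.sum_comp fun w => traceChar p (w * (b ^ Q * z ^ (Q * Q) + b * z))
        rw [this, sum_traceChar_mul]
        split_ifs with hz
        · have hy : (b * z ^ (Q + 1)) ^ p ^ j = -(b * z ^ (Q + 1)) := by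
            rw [← hQ, mul_pow, ← pow_mul, add_mul, pow_add, one_mul]
            linear_combination z ^ Q * hz
          rw [traceChar_apply, trace_eq_zero_of_pow_eq_neg p hF hy, AddChar.map_zero_eq_one,
            one_mul]
        · rw [mul_zero]
    _ = _ := by
        rw [← sum_filter, sum_const, nsmul_eq_mul, mul_comm]

/-- The number of zeros of the linearized polynomial attached to the form `tr(b z^(Q+1))`. -/
theorem card_radical {Q E : ℕ} (hQ : 2 ≤ Q)
    (h : Fintype.card F = (Q + 1) * ((Q - 1) * E) + 1) {b : F} (hb : b ≠ 0) :
    #{z : F | b ^ Q * z ^ (Q * Q) + b * z = 0} =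
      if b ^ ((Q - 1) * E) = (-1) ^ E then Q ^ 2 else 1 := by
  obtain ⟨P, rfl⟩ : ∃ P, Q = P + 1 := ⟨Q - 1, by omega⟩
  have h' : Fintype.card F = ((P + 1 + 1) * P) * E + 1 := by
    rw [h, Nat.add_sub_cancel]; ring
  have hP : P ≠ 0 := by omega
  have hc : -(b ^ P)⁻¹ ≠ 0 := neg_ne_zero.mpr (inv_ne_zero (pow_ne_zero _ hb))
  have hins : ({z : F | b ^ (P + 1) * z ^ ((P + 1) * (P + 1)) + b * z = 0} : Finset F) =
      insert 0 ({z : F | z ^ ((P + 1 + 1) * P) = -(b ^ P)⁻¹} : Finset F) := by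
    ext z
    by_cases hz : z = 0
    · simp [hz]
    simp only [mem_filter, mem_univ, true_and, mem_insert, hz, false_or]
    -- With `Q = P + 1`, nonzero zeros are the roots of `z^(Q^2-1) = -b^(1-Q)`: none, or `Q^2 - 1`
    -- of them.
    have hfac : b ^ (P + 1) * z ^ ((P + 1) * (P + 1)) + b * z =
        b ^ (P + 1) * z * (z ^ ((P + 1 + 1) * P) - -(b ^ P)⁻¹) := by
      field_simp
      ring
    rw [hfac, mul_eq_zero, sub_eq_zero]
    simp [hb, hz]
  rw [hins, card_insert_of_notMem, card_filter_pow_eq h' hc]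
  · have : (-(b ^ P)⁻¹) ^ E = 1 ↔ b ^ ((P + 1 - 1) * E) = (-1) ^ E := by
      rw [Nat.add_sub_cancel, pow_mul, neg_pow, inv_pow, mul_inv_eq_one₀ (pow_ne_zero _ (pow_ne_zero _ hb))]
      exact eq_comm
    simp only [this]
    split_ifs <;> ring
  · simp [hP, hb, zero_pow]

/-- Modulo `Q + 1` both `x` and `(-Q)^u` are `1`; the opposite sign would force `Q + 1` to divide
`2`. -/
theorem eq_neg_pow_of_sq_eq {Q u : ℕ} (hQ : 2 ≤ Q) {x j : ℤ} (hx : x = 1 + ((Q : ℤ) + 1) * j)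
    (hsq : x ^ 2 = ((Q : ℤ) ^ u) ^ 2) : x = (-(Q : ℤ)) ^ u := by
  have hsq' : x ^ 2 = ((-(Q : ℤ)) ^ u) ^ 2 := by
    rw [hsq, ← pow_mul, ← pow_mul, mul_comm u, pow_mul, pow_mul, neg_sq]
  rcases sq_eq_sq_iff_eq_or_eq_neg.mp hsq' with h | h
  · exact h
  · exfalso
    obtain ⟨v, hv⟩ : ((Q : ℤ) + 1) ∣ (-(Q : ℤ)) ^ u - 1 ^ u :=
      dvd_trans ⟨-1, by ring⟩ (sub_dvd_pow_sub_pow (-(Q : ℤ)) 1 u)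
    rw [one_pow] at hv
    have h2 : ((Q : ℤ) + 1) ∣ 2 := ⟨-(j + v), by linear_combination -hx + h - hv⟩
    have := Int.le_of_dvd (by norm_num) h2
    omega

theorem powSum_char_pow_add_one {j t E : ℕ} (hj : 0 < j)
    (hF : Fintype.card F = p ^ (2 * j * t))
    (h : Fintype.card F = (p ^ j + 1) * ((p ^ j - 1) * E) + 1) {b : F} (hb : b ≠ 0) :
    powSum p (p ^ j + 1) b =
      (-(p : ℂ) ^ j) ^ t * (1 - if b ^ ((p ^ j - 1) * E) = (-1) ^ E then (p : ℂ) ^ j + 1 else 0) := by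
  have hp : p.Prime := Fact.out
  have hQ : 2 ≤ p ^ j := hp.two_le.trans (Nat.le_self_pow hj.ne' p)
  obtain ⟨G, hG⟩ : p - 1 ∣ p ^ j - 1 := by simpa using Nat.sub_dvd_pow_sub_pow p 1 j
  have h' : Fintype.card F = (p ^ j + 1) * ((p - 1) * (G * E)) + 1 := by
    rw [h, hG]; ring
  obtain ⟨i, hi⟩ := exists_powSum_eq p h' b
  have hsq := powSum_sq p hF h' b
  rw [card_radical hQ h hb, hF] at hsq
  have hint : ((1 + ((p ^ j : ℕ) + 1 : ℤ) * i : ℤ) : ℂ) = powSum p (p ^ j + 1) b := by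
    rw [hi]; push_cast; ring
  rw [← hint] at hsq ⊢
  split_ifs at hsq ⊢ with hs
  · have := eq_neg_pow_of_sq_eq (u := t + 1) hQ rfl (j := i) (by
      have : ((1 + ((p ^ j : ℕ) + 1 : ℤ) * i : ℤ) ^ 2 : ℂ) = (((p ^ j : ℕ) : ℤ) ^ (t + 1) : ℤ) ^ 2 := by
        rw [hsq]; push_cast; ring
      exact_mod_cast this)
    rw [this]; push_cast; ring
  · have := eq_neg_pow_of_sq_eq (u := t) hQ rfl (j := i) (by
      have : ((1 + ((p ^ j : ℕ) + 1 : ℤ) * i : ℤ) ^ 2 : ℂ) = (((p ^ j : ℕ) : ℤ) ^ t : ℤ) ^ 2 := by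
        rw [hsq]; push_cast; ring
      exact_mod_cast this)
    rw [this]; push_cast; ring

/-- Passes from exponent `nl` down to `n`: for fixed `w ≠ 0`, `z^n w^(nl) = (w^l z)^n`, and `z ↦ w^l
z` permutes `F`. -/
theorem sum_powSum_mul_pow {n l : ℕ} (hn : 0 < n) (hl : 0 < l) (a : F) :
    ∑ z ∈ univ.erase (0 : F), powSum p (n * l) (a * z ^ n) =
      ((Fintype.card F : ℂ) - 1) * powSum p n a := by
  have hcard : ((univ.erase (0 : F)).card : ℂ) = (Fintype.card F : ℂ) - 1 := by
    rw [card_erase_of_mem (mem_univ _), card_univ, Nat.cast_sub Fintype.card_pos, Nat.cast_one]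
  simp only [powSum]
  rw [sum_comm, ← add_sum_erase univ _ (mem_univ (0 : F))]
  have h0 : ∑ z ∈ univ.erase (0 : F), traceChar p (a * z ^ n * 0 ^ (n * l)) =
      (Fintype.card F : ℂ) - 1 := by
    rw [zero_pow (by positivity)]
    simp [← hcard]
  have h1 : ∀ w ∈ univ.erase (0 : F),
      ∑ z ∈ univ.erase (0 : F), traceChar p (a * z ^ n * w ^ (n * l)) =
        (∑ z : F, traceChar p (a * z ^ n)) - 1 := fun w hw => by
    have hw0 : w ≠ 0 := by simpa using hw
    have := add_sum_erase univ (fun z => traceChar p (a * z ^ n * w ^ (n * l))) (mem_univ (0 : F))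
    rw [← Equiv.sum_comp (Equiv.mulLeft₀ (w ^ l) (pow_ne_zero l hw0))
      (fun z => traceChar p (a * z ^ n)), eq_sub_iff_add_eq']
    simp only [zero_pow hn.ne', mul_zero, zero_mul, AddChar.map_zero_eq_one] at this
    rw [this]
    refine sum_congr rfl fun z _ => ?_
    congr 1
    simp only [Equiv.mulLeft₀_apply]
    ring
  rw [h0, sum_congr rfl h1, sum_const, nsmul_eq_mul, hcard]
  ring

theorem powSum_semiprimitive {n l j t E : ℕ} (hj : 0 < j) (hnl : p ^ j + 1 = n * l)
    (hF : Fintype.card F = p ^ (2 * j * t))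
    (h : Fintype.card F = (p ^ j + 1) * ((p ^ j - 1) * E) + 1) {a : F} (ha : a ≠ 0) :
    powSum p n a = (-(p : ℂ) ^ j) ^ t *
      (1 - if a ^ (l * ((p ^ j - 1) * E)) = (-1) ^ (l * E) then (n : ℂ) else 0) := by
  have hn : 0 < n := Nat.pos_of_ne_zero (by rintro rfl; simp at hnl)
  have hl : 0 < l := Nat.pos_of_ne_zero (by rintro rfl; simp at hnl)
  have key := sum_powSum_mul_pow p hn hl a
  have hq1 : (Fintype.card F : ℂ) - 1 ≠ 0 :=
    sub_ne_zero.mpr (by exact_mod_cast (Fintype.one_lt_card (α := F)).ne')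
  apply mul_left_cancel₀ hq1
  rw [← key, ← hnl]
  set e := (p ^ j - 1) * E with he
  have hcard' : Fintype.card F = (n * e) * l + 1 := by rw [h, hnl]; ring
  have he0 : 0 < e := by
    have hcard := Fintype.one_lt_card (α := F)
    exact Nat.pos_of_mul_pos_left (b := e) (a := p ^ j + 1) (by omega)
  have hc : (-1) ^ E * (a ^ e)⁻¹ ≠ 0 :=
    mul_ne_zero (pow_ne_zero _ (by simp)) (inv_ne_zero (pow_ne_zero _ ha))
  have hcount : #{z ∈ univ.erase (0 : F) | (a * z ^ n) ^ e = (-1) ^ E} =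
      if a ^ (l * e) = (-1) ^ (l * E) then n * e else 0 := by
    have hset : ({z ∈ univ.erase (0 : F) | (a * z ^ n) ^ e = (-1) ^ E}) =
        ({z : F | z ^ (n * e) = (-1) ^ E * (a ^ e)⁻¹} : Finset F) := by
      ext z
      simp only [mem_filter, mem_erase, mem_univ, true_and, and_true]
      rw [eq_mul_inv_iff_mul_eq₀ (pow_ne_zero _ ha), mul_pow, ← pow_mul, mul_comm (a ^ e)]
      refine and_iff_right_of_imp ?_
      rintro hz rfl
      rw [zero_pow (by positivity), zero_mul] at hz
      exact pow_ne_zero E (by simp) hz.symm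
    rw [hset, card_filter_pow_eq hcard' hc]
    congr 1
    rw [mul_pow, inv_pow, mul_inv_eq_one₀ (pow_ne_zero _ (pow_ne_zero _ ha)), ← pow_mul,
      ← pow_mul, mul_comm E, mul_comm e]
    exact propext eq_comm
  have hval : ∀ z ∈ univ.erase (0 : F), powSum p (p ^ j + 1) (a * z ^ n) =
      (-(p : ℂ) ^ j) ^ t - (-(p : ℂ) ^ j) ^ t * ((p : ℂ) ^ j + 1) *
        if (a * z ^ n) ^ e = (-1) ^ E then 1 else 0 := fun z hz => by
    rw [powSum_char_pow_add_one p hj hF h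
      (mul_ne_zero ha (pow_ne_zero _ (by simpa using hz)))]
    split_ifs <;> ring
  rw [sum_congr rfl hval, sum_sub_distrib, sum_const, ← mul_sum, sum_boole, hcount,
    card_erase_of_mem (mem_univ _), card_univ, nsmul_eq_mul, Nat.cast_sub Fintype.card_pos,
    Nat.cast_one]
  -- The count `n * e` of exceptional `z` is weighted by `Q + 1 = nl`; since `q - 1 = nel`, the
  -- product is `n(q - 1)`, and `q - 1` cancels.
  have hnl' : (p : ℂ) ^ j + 1 = n * l := by exact_mod_cast hnl
  have hcc : (Fintype.card F : ℂ) = n * e * l + 1 := by rw [hcard']; push_cast; ring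
  rw [hnl', hcc]
  split_ifs <;> push_cast <;> ring

end Semiprimitive

/-! ### The set `D'` as representatives of `n`-th powers modulo scalars -/

section BaseSet

open Finset Classical

variable {F : Type*} [Field F] [Fintype F] (p : ℕ) [Fact p.Prime]

/-- The number `M` is `n_1`. The gcd identity serves to compute the order of `α^(N(p-1))`, which is
`M`. -/
theorem exists_eq_gcdN_mul {m N : ℕ} (hm : m ≠ 0) (hN : 0 < N) :
    ∃ M, 0 < M ∧ p ^ m - 1 = (p - 1) * (gcdN p m N * M) ∧ lcmN p m N / N = M ∧
      Nat.gcd ((p - 1) * (gcdN p m N * M)) (N * (p - 1)) = gcdN p m N * (p - 1) := by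
  have hp : p.Prime := Fact.out
  obtain ⟨K, hK⟩ : p - 1 ∣ p ^ m - 1 := by simpa using Nat.sub_dvd_pow_sub_pow p 1 m
  have hp1 : 0 < p - 1 := by have := hp.two_le; omega
  have hdiv : (p ^ m - 1) / (p - 1) = K := by rw [hK, Nat.mul_div_cancel_left _ hp1]
  have hK0 : 0 < K := by
    have := Nat.one_lt_pow hm hp.one_lt
    exact Nat.pos_of_mul_pos_left (b := K) (a := p - 1) (by omega)
  have hg : 0 < Nat.gcd N K := Nat.gcd_pos_of_pos_left _ hN
  obtain ⟨M, hM⟩ := Nat.gcd_dvd_right N K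
  refine ⟨M, ?_, ?_, ?_, ?_⟩
  · exact Nat.pos_of_mul_pos_left (b := M) (a := Nat.gcd N K) (by omega)
  · rw [gcdN, hdiv, ← hM, hK]
  · rw [lcmN, hdiv]
    refine Nat.div_eq_of_eq_mul_right hN ?_
    have := Nat.gcd_mul_lcm N K
    apply Nat.eq_of_mul_eq_mul_left hg
    rw [this]
    nth_rw 1 [hM]
    ring
  · rw [gcdN, hdiv, ← hM, mul_comm, Nat.gcd_mul_right, Nat.gcd_comm]

variable {m N : ℕ} {α : F}

/-- The map `y ↦ y^(p-1)` has the nonzero scalars of `𝔽_p` as kernel. It sends `D'` to the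
successive powers of `α^(N(p-1))`, an element of order `M`, hence bijectively onto the `M`-th roots
of unity. -/
theorem image_pow_baseSet (hm : m ≠ 0) (hF : Fintype.card F = p ^ m)
    (hα : IsPrimitiveRoot α (p ^ m - 1)) (hN : 0 < N) :
    Set.InjOn (fun y : F => y ^ (p - 1)) (baseSet p m N α) ∧
      ({y | y ∈ baseSet p m N α} : Finset F).image (fun y => y ^ (p - 1)) =
        ({w : F | w ^ (lcmN p m N / N) = 1} : Finset F) ∧
      #({y | y ∈ baseSet p m N α} : Finset F) = lcmN p m N / N := by
  have hp : p.Prime := Fact.out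
  obtain ⟨M, hM0, hM, hlcm, hgcd⟩ := exists_eq_gcdN_mul p hm hN
  have hpos : 0 < p ^ m - 1 := by have := Nat.one_lt_pow hm hp.one_lt; omega
  have hord : orderOf (α ^ (N * (p - 1))) = M := by
    rw [orderOf_pow' _ (mul_ne_zero hN.ne' (by have := hp.two_le; omega)), ← hα.eq_orderOf,
      hM, hgcd]
    refine Nat.div_eq_of_eq_mul_left ?_ (by ring)
    rw [hM] at hpos
    exact Nat.pos_of_ne_zero (by intro h0; apply hpos.ne'; rw [← mul_assoc, mul_comm (p - 1), h0, zero_mul])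
  have hB : ({y | y ∈ baseSet p m N α} : Finset F) =
      (range M).image (fun i => α ^ (N * i)) := by
    ext y
    simp only [mem_filter, mem_univ, true_and, mem_image, mem_range, baseSet, hlcm,
      Set.mem_ofPred_eq]
    constructor
    · rintro ⟨i, h1, h2, rfl⟩
      exact ⟨i - 1, by omega, rfl⟩
    · rintro ⟨i, h1, rfl⟩
      exact ⟨i + 1, by omega, by omega, rfl⟩
  have hpow : ∀ i, (α ^ (N * i)) ^ (p - 1) = (α ^ (N * (p - 1))) ^ i := fun i => by
    rw [← pow_mul, ← pow_mul]; congr 1; ring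
  have hinj : ∀ i < M, ∀ i' < M, (α ^ (N * i)) ^ (p - 1) = (α ^ (N * i')) ^ (p - 1) → i = i' := by
    intro i hi i' hi' h
    rw [hpow, hpow] at h
    exact pow_injOn_Iio_orderOf (by rwa [hord]) (by rwa [hord]) h
  have hmem : ∀ y ∈ baseSet p m N α, ∃ i < M, y = α ^ (N * i) := by
    rintro y ⟨i, h1, h2, rfl⟩
    exact ⟨i - 1, by omega, rfl⟩
  have hinjOn : Set.InjOn (fun y : F => y ^ (p - 1)) (baseSet p m N α) := by
    intro y hy y' hy' h
    obtain ⟨i, hi, rfl⟩ := hmem y hy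
    obtain ⟨i', hi', rfl⟩ := hmem y' hy'
    rw [hinj i hi i' hi' h]
  have hcard : #({y | y ∈ baseSet p m N α} : Finset F) = M := by
    rw [hB, card_image_of_injOn, card_range]
    intro i hi i' hi' h
    exact hinj i (by simpa using hi) i' (by simpa using hi') (by simp only at h; rw [h])
  refine ⟨hinjOn, ?_, hcard.trans hlcm.symm⟩
  refine eq_of_subset_of_card_le ?_ ?_
  · rw [hB, image_image]
    intro w hw
    obtain ⟨i, hi, rfl⟩ := mem_image.mp hw
    simp only [mem_filter, mem_univ, true_and, Function.comp_apply]
    rw [hpow, hlcm, pow_right_comm, ← hord, pow_orderOf_eq_one, one_pow]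
  · rw [card_image_of_injOn (by simpa using hinjOn), hcard, hlcm,
      card_filter_pow_eq (d := M) (e := gcdN p m N * (p - 1)) _ one_ne_zero]
    · simp
    · rw [hF, show M * (gcdN p m N * (p - 1)) = (p - 1) * (gcdN p m N * M) by ring, ← hM]
      omega

variable [Algebra (ZMod p) F]

/-- Each nonzero `z` has `z^n` equal to an `𝔽_p`-multiple of exactly one `y` in `D'`, and each `y`
arises from `n(p-1)` such `z`. A nonzero scalar does not affect vanishing of the trace. -/
theorem mul_card_baseSet_filter (hm : m ≠ 0) (hF : Fintype.card F = p ^ m)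
    (hα : IsPrimitiveRoot α (p ^ m - 1)) (hN : 0 < N) (a : F) :
    #{z : F | Algebra.trace (ZMod p) F (a * z ^ gcdN p m N) ≠ 0} =
      gcdN p m N * (p - 1) *
        #{y : F | y ∈ baseSet p m N α ∧ Algebra.trace (ZMod p) F (a * y) ≠ 0} := by
  have hp : p.Prime := Fact.out
  obtain ⟨M, hM0, hM, hlcm, -⟩ := exists_eq_gcdN_mul p hm hN
  obtain ⟨hinj, himage, -⟩ := image_pow_baseSet p hm hF hα hN
  rw [hlcm] at himage
  set n := gcdN p m N with hn
  have hn0 : 0 < n := Nat.gcd_pos_of_pos_left _ hN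
  have hp1 : 0 < p - 1 := by have := hp.two_le; omega
  have hcard : Fintype.card F = (n * (p - 1)) * M + 1 := by
    have := Nat.one_lt_pow hm hp.one_lt
    rw [hF, show n * (p - 1) * M = (p - 1) * (n * M) by ring, ← hM]
    omega
  have hB0 : ∀ y ∈ baseSet p m N α, y ≠ 0 := by
    rintro y ⟨i, -, -, rfl⟩
    have := Nat.one_lt_pow hm hp.one_lt
    exact pow_ne_zero _ (hα.ne_zero (by omega))
  have htr : ∀ y ∈ baseSet p m N α, ∀ z : F, z ^ (n * (p - 1)) = y ^ (p - 1) →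
      (Algebra.trace (ZMod p) F (a * z ^ n) ≠ 0 ↔ Algebra.trace (ZMod p) F (a * y) ≠ 0) := by
    intro y hy z hz
    have hy0 := hB0 y hy
    rw [pow_mul] at hz
    have h1 : (z ^ n / y) ^ (p - 1) = 1 := by
      rw [div_pow, hz, div_self (pow_ne_zero _ hy0)]
    have h2 : (z ^ n / y) ^ p = z ^ n / y := by
      rw [← Nat.sub_add_cancel hp.one_le, pow_succ, h1, one_mul]
    obtain ⟨c, hc⟩ := exists_algebraMap_eq_of_pow_eq_self p h2
    have hc0 : c ≠ 0 := by
      rintro rfl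
      rw [map_zero] at hc
      rw [← hc, zero_pow hp1.ne'] at h1
      exact zero_ne_one h1
    rw [eq_div_iff hy0] at hc
    rw [← hc, mul_left_comm, trace_algebraMap_mul]
    simp [hc0]
  rw [card_eq_sum_card_fiberwise (f := fun z => z ^ (n * (p - 1)))
    (t := ({y | y ∈ baseSet p m N α ∧ Algebra.trace (ZMod p) F (a * y) ≠ 0} : Finset F).image
      (fun y => y ^ (p - 1)))]
  · rw [sum_image (by
      intro y hy y' hy' h
      simp only [coe_filter, mem_univ, true_and, Set.mem_ofPred_eq] at hy hy'
      exact hinj hy.1 hy'.1 h), sum_const_nat (m := n * (p - 1)), mul_comm]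
    intro y hy
    simp only [mem_filter, mem_univ, true_and] at hy
    have : ({z ∈ ({z : F | Algebra.trace (ZMod p) F (a * z ^ n) ≠ 0} : Finset F) |
        z ^ (n * (p - 1)) = y ^ (p - 1)}) =
        ({z : F | z ^ (n * (p - 1)) = y ^ (p - 1)} : Finset F) := by
      ext z
      simp only [mem_filter, mem_univ, true_and, and_iff_right_iff_imp]
      exact fun hz => (htr y hy.1 z hz).mpr hy.2
    have hyB : y ^ (p - 1) ∈ ({w : F | w ^ M = 1} : Finset F) := by
      rw [← himage]
      exact mem_image_of_mem _ (by simpa using hy.1)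
    rw [this, card_filter_pow_eq hcard (pow_ne_zero _ (hB0 y hy.1)), if_pos (by simpa using hyB)]
  · intro z hz
    simp only [coe_filter, mem_univ, true_and, Set.mem_ofPred_eq] at hz
    have hz0 : z ≠ 0 := by
      rintro rfl
      simp [hn0.ne'] at hz
    have hzm : z ^ (n * (p - 1)) ∈ ({w : F | w ^ M = 1} : Finset F) := by
      simp only [mem_filter, mem_univ, true_and]
      rw [← pow_mul, pow_mul_eq_one hcard hz0]
    rw [← himage] at hzm
    obtain ⟨y, hy, hyz⟩ := mem_image.mp hzm
    have hy' : y ∈ baseSet p m N α := by simpa using hy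
    exact mem_image.mpr ⟨y, by simpa using ⟨hy', (htr y hy' z hyz.symm).mp hz⟩, hyz⟩

theorem mul_card_baseSet_filter_eq_sub_powSum (hm : m ≠ 0) (hF : Fintype.card F = p ^ m)
    (hα : IsPrimitiveRoot α (p ^ m - 1)) (hN : 0 < N) (a : F) :
    (p : ℂ) * gcdN p m N *
        #{y : F | y ∈ baseSet p m N α ∧ Algebra.trace (ZMod p) F (a * y) ≠ 0} =
      (p : ℂ) ^ m - powSum p (gcdN p m N) a := by
  have hp : p.Prime := Fact.out
  obtain ⟨M, hM0, hM, hlcm, -⟩ := exists_eq_gcdN_mul p hm hN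
  have hcard : Fintype.card F = gcdN p m N * ((p - 1) * M) + 1 := by
    have := Nat.one_lt_pow hm hp.one_lt
    rw [hF, mul_left_comm, ← hM]
    omega
  have h1 := card_add_mul_powSum p hcard a
  have h2 := mul_card_baseSet_filter p hm hF hα hN a
  have h3 := card_filter_add_card_filter_not (s := (univ : Finset F))
    (fun z => Algebra.trace (ZMod p) F (a * z ^ gcdN p m N) = 0)
  have h2' : #{z : F | ¬ Algebra.trace (ZMod p) F (a * z ^ gcdN p m N) = 0} = _ := h2
  rw [h2', card_univ, hF] at h3
  have hpc : (p : ℂ) - 1 ≠ 0 := sub_ne_zero.mpr (by exact_mod_cast hp.ne_one)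
  have h3' : (#{z : F | Algebra.trace (ZMod p) F (a * z ^ gcdN p m N) = 0} : ℂ) +
      gcdN p m N * (p - 1) *
        #{y : F | y ∈ baseSet p m N α ∧ Algebra.trace (ZMod p) F (a * y) ≠ 0} = (p : ℂ) ^ m := by
    rw [← Nat.cast_one, ← Nat.cast_sub hp.one_le]
    exact_mod_cast h3
  apply mul_left_cancel₀ hpc
  rw [hF] at h1
  push_cast at h1
  linear_combination h1 + (p : ℂ) * h3'

theorem exists_card_baseSet_filter {k' t : ℕ} (hk' : 0 < k') (ht : m = 2 * k' * t) (hm : m ≠ 0)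
    (hF : Fintype.card F = p ^ m) (hα : IsPrimitiveRoot α (p ^ m - 1)) (hN : 0 < N)
    (hsemi : gcdN p m N ∣ p ^ k' + 1) :
    ∃ S : Finset F, (0 : F) ∉ S ∧ gcdN p m N * #S = p ^ m - 1 ∧ ∀ a ≠ 0,
      (p : ℤ) * gcdN p m N *
        #{y : F | y ∈ baseSet p m N α ∧ Algebra.trace (ZMod p) F (a * y) ≠ 0} =
      (p : ℤ) ^ m - (-1) ^ t * (p : ℤ) ^ (m / 2) * (1 - if a ∈ S then (gcdN p m N : ℤ) else 0) := by
  have hp : p.Prime := Fact.out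
  have : CharP F p := charP_of_injective_algebraMap (algebraMap (ZMod p) F).injective p
  obtain ⟨l, hl⟩ := hsemi
  set n := gcdN p m N with hn
  have hn0 : 0 < n := Nat.gcd_pos_of_pos_left _ hN
  have hq : 1 < p ^ m := Nat.one_lt_pow hm hp.one_lt
  have hE : ∃ E, Fintype.card F = (p ^ k' + 1) * ((p ^ k' - 1) * E) + 1 := by
    obtain ⟨E, hE⟩ : (p ^ k') ^ 2 - 1 ∣ p ^ m - 1 := by
      have := Nat.sub_dvd_pow_sub_pow ((p ^ k') ^ 2) 1 t
      rwa [one_pow, show ((p ^ k') ^ 2) ^ t = p ^ m by rw [ht]; ring] at this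
    refine ⟨E, ?_⟩
    have h1 : (p ^ k') ^ 2 - 1 = (p ^ k' + 1) * (p ^ k' - 1) := by
      simpa using Nat.sq_sub_sq (p ^ k') 1
    rw [hF, ← mul_assoc, ← h1, ← hE]
    omega
  obtain ⟨E, hE⟩ := hE
  have hcard : Fintype.card F = (l * ((p ^ k' - 1) * E)) * n + 1 := by
    rw [hE, hl]; ring
  have hle : l * ((p ^ k' - 1) * E) ≠ 0 := by
    intro h0
    rw [h0, hF] at hcard
    omega
  -- Frobenius gives `(-1)^(p^k') = -1` in every characteristic, so `p = 2` needs no separate case.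
  -- This makes the exceptional coset nonempty.
  have hneg : ((-1 : F) ^ (l * E)) ^ n = 1 := by
    rw [← pow_mul, show l * E * n = (p ^ k' + 1) * E by rw [hl]; ring, pow_mul, pow_succ]
    have := map_neg (iterateFrobenius F p k') 1
    rw [map_one, iterateFrobenius_def] at this
    rw [this]
    simp
  refine ⟨({a : F | a ^ (l * ((p ^ k' - 1) * E)) = (-1) ^ (l * E)} : Finset F), ?_, ?_, fun a ha => ?_⟩
  · simp only [mem_filter, mem_univ, true_and, zero_pow hle]
    exact (pow_ne_zero _ (by simp)).symm
  · rw [card_filter_pow_eq hcard (pow_ne_zero _ (by simp)), if_pos hneg, ← hF, hcard]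
    simp [mul_comm]
  · have h1 := mul_card_baseSet_filter_eq_sub_powSum p hm hF hα hN a
    rw [powSum_semiprimitive p hk' hl (by rw [hF, ht]) hE ha] at h1
    have hr : (-(p : ℂ) ^ k') ^ t = (-1) ^ t * (p : ℂ) ^ (m / 2) := by
      rw [neg_pow, ← pow_mul, ht, mul_assoc, Nat.mul_div_cancel_left _ two_pos]
    rw [hr] at h1
    simp only [mem_filter, mem_univ, true_and]
    have h2 : (((p : ℤ) * n *
        #{y : F | y ∈ baseSet p m N α ∧ Algebra.trace (ZMod p) F (a * y) ≠ 0} : ℤ) : ℂ) =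
        (((p : ℤ) ^ m - (-1) ^ t * (p : ℤ) ^ (m / 2) *
          (1 - if a ^ (l * ((p ^ k' - 1) * E)) = (-1) ^ (l * E) then (n : ℤ) else 0) : ℤ) : ℂ) := by
      push_cast
      exact h1
    exact_mod_cast h2

end BaseSet

/-! ### Coefficients in the chain ring -/

section Coefficients

variable {F : Type*} [Field F] {k : ℕ}

theorem uCoeff_mk (f : F[X]) {i : ℕ} (hi : i < k) :
    uCoeff (AdjoinRoot.mk (X ^ k : F[X]) f) i = f.coeff i := by
  rw [uCoeff, AdjoinRoot.modByMonicHom_mk]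
  conv_rhs => rw [← modByMonic_add_div f (X ^ k)]
  rw [coeff_add, coeff_X_pow_mul', if_neg (by omega), add_zero]

theorem uCoeff_add (a b : ChainRing F k) (i : ℕ) :
    uCoeff (a + b) i = uCoeff a i + uCoeff b i := by
  simp [uCoeff]

theorem uCoeff_zero (i : ℕ) : uCoeff (0 : ChainRing F k) i = 0 := by
  simp [uCoeff]

theorem uCoeff_ext {a b : ChainRing F k} (h : ∀ i < k, uCoeff a i = uCoeff b i) : a = b := by
  obtain ⟨f, rfl⟩ := AdjoinRoot.mk_surjective a
  obtain ⟨g, rfl⟩ := AdjoinRoot.mk_surjective b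
  rw [AdjoinRoot.mk_eq_mk, X_pow_dvd_iff]
  intro i hi
  have := h i hi
  rw [uCoeff_mk f hi, uCoeff_mk g hi] at this
  rw [coeff_sub, this, sub_self]

theorem uCoeff_mul (a b : ChainRing F k) {i : ℕ} (hi : i < k) :
    uCoeff (a * b) i = ∑ x ∈ Finset.HasAntidiagonal.antidiagonal i, uCoeff a x.1 * uCoeff b x.2 := by
  obtain ⟨f, rfl⟩ := AdjoinRoot.mk_surjective a
  obtain ⟨g, rfl⟩ := AdjoinRoot.mk_surjective b
  rw [← map_mul, uCoeff_mk _ hi, coeff_mul]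
  refine Finset.sum_congr rfl fun x hx => ?_
  have := Finset.HasAntidiagonal.mem_antidiagonal.mp hx
  rw [uCoeff_mk _ (by omega), uCoeff_mk _ (by omega)]

/-- The element `∑ i < k, f i * u ^ i` of the chain ring. -/
noncomputable def ofCoeff (k : ℕ) (f : ℕ → F) : ChainRing F k :=
  AdjoinRoot.mk (X ^ k : F[X]) (∑ i ∈ Finset.range k, C (f i) * X ^ i)

theorem uCoeff_ofCoeff (f : ℕ → F) {i : ℕ} (hi : i < k) : uCoeff (ofCoeff k f) i = f i := by
  rw [ofCoeff, uCoeff_mk _ hi, finsetSum_coeff]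
  simp [coeff_X_pow, hi]

/-- The monomial `v * u ^ r` of the chain ring. -/
noncomputable def uMonomial (k r : ℕ) (v : F) : ChainRing F k :=
  AdjoinRoot.mk (X ^ k : F[X]) (C v * X ^ r)

theorem uCoeff_uMonomial (r : ℕ) (v : F) {i : ℕ} (hi : i < k) :
    uCoeff (uMonomial k r v) i = if i = r then v else 0 := by
  rw [uMonomial, uCoeff_mk _ hi, coeff_C_mul_X_pow]

theorem uCoeff_mul_uMonomial (a : ChainRing F k) (r : ℕ) (v : F) {i : ℕ} (hi : i < k) :
    uCoeff (a * uMonomial k r v) i = if r ≤ i then uCoeff a (i - r) * v else 0 := by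
  obtain ⟨f, rfl⟩ := AdjoinRoot.mk_surjective a
  rw [uMonomial, ← map_mul, uCoeff_mk _ hi, uCoeff_mk _ (by omega), ← mul_assoc,
    coeff_mul_X_pow', coeff_mul_C]

theorem eq_uMonomial {x : ChainRing F k} (hx : ∀ i < k - 1, uCoeff x i = 0) :
    x = uMonomial k (k - 1) (uCoeff x (k - 1)) := by
  refine uCoeff_ext fun i hi => ?_
  rw [uCoeff_uMonomial _ _ hi]
  split_ifs with h
  · rw [h]
  · exact hx i (by omega)

theorem mem_span_uElt_pow {j : ℕ} (hj : j ≤ k) (a : ChainRing F k) :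
    a ∈ Ideal.span {uElt F k ^ j} ↔ ∀ i < j, uCoeff a i = 0 := by
  obtain ⟨f, rfl⟩ := AdjoinRoot.mk_surjective a
  rw [Ideal.mem_span_singleton, uElt, ← AdjoinRoot.mk_X, ← map_pow]
  constructor
  · rintro ⟨b, hb⟩ i hi
    obtain ⟨g, rfl⟩ := AdjoinRoot.mk_surjective b
    rw [hb, ← map_mul, uCoeff_mk _ (by omega), coeff_X_pow_mul', if_neg (by omega)]
  · intro h
    refine map_dvd _ (X_pow_dvd_iff.mpr fun i hi => ?_)
    rw [← h i hi, uCoeff_mk _ (by omega)]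

theorem bijective_uCoeff :
    Function.Bijective (fun (a : ChainRing F k) (i : Fin k) => uCoeff a i) := by
  refine ⟨fun a b h => uCoeff_ext fun i hi => congrFun h ⟨i, hi⟩, fun f => ?_⟩
  refine ⟨ofCoeff k fun i => if h : i < k then f ⟨i, h⟩ else 0, funext fun i => ?_⟩
  simp [uCoeff_ofCoeff]

end Coefficients

/-! ### Linearity of the generalized trace and of the code -/

section Trace

variable (p : ℕ) [Fact p.Prime] {F : Type*} [Field F] [Algebra (ZMod p) F] {k : ℕ}

theorem uCoeff_genTrace (a : ChainRing F k) {i : ℕ} (hi : i < k) :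
    uCoeff (genTrace p a) i = Algebra.trace (ZMod p) F (uCoeff a i) := by
  have : genTrace p a = ofCoeff k fun i => Algebra.trace (ZMod p) F (uCoeff a i) := by
    rw [genTrace, ofCoeff, map_sum]
    refine Finset.sum_congr rfl fun i _ => ?_
    rw [map_mul, map_pow, AdjoinRoot.mk_X, AdjoinRoot.mk_C]
    rfl
  rw [this, uCoeff_ofCoeff _ hi]

theorem genTrace_add (a b : ChainRing F k) :
    genTrace p (a + b) = genTrace p a + genTrace p b := by
  refine uCoeff_ext fun i hi => ?_
  rw [uCoeff_add, uCoeff_genTrace p _ hi, uCoeff_genTrace p _ hi, uCoeff_genTrace p _ hi,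
    uCoeff_add, map_add]

theorem genTrace_zero : genTrace p (0 : ChainRing F k) = 0 := by
  refine uCoeff_ext fun i hi => ?_
  rw [uCoeff_genTrace p _ hi, uCoeff_zero, uCoeff_zero, map_zero]

/-- Lifting `c` coefficientwise to the larger ring turns `R`-scaling of a codeword into
multiplication of its parameter. -/
theorem genTrace_ofCoeff_mul (c : ChainRing (ZMod p) k) (a : ChainRing F k) :
    genTrace p (ofCoeff k (fun i => algebraMap (ZMod p) F (uCoeff c i)) * a) =
      c * genTrace p a := by
  refine uCoeff_ext fun i hi => ?_
  rw [uCoeff_genTrace p _ hi, uCoeff_mul _ _ hi, uCoeff_mul _ _ hi, map_sum]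
  refine Finset.sum_congr rfl fun x hx => ?_
  have := Finset.HasAntidiagonal.mem_antidiagonal.mp hx
  rw [uCoeff_ofCoeff _ (by omega), uCoeff_genTrace p _ (by omega), trace_algebraMap_mul]

theorem isLinearCode_traceCode (D : Set (ChainRing F k)) : IsLinearCode (traceCode p D) := by
  refine ⟨{ carrier := traceCode p D, add_mem' := ?_, zero_mem' := ?_, smul_mem' := ?_ }, rfl⟩
  · rintro _ _ ⟨x, rfl⟩ ⟨y, rfl⟩
    refine ⟨x + y, funext fun d => ?_⟩
    rw [Pi.add_apply, add_mul, genTrace_add]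
  · refine ⟨0, funext fun d => ?_⟩
    rw [zero_mul, genTrace_zero, Pi.zero_apply]
  · rintro c _ ⟨x, rfl⟩
    refine ⟨ofCoeff k (fun i => algebraMap (ZMod p) F (uCoeff c i)) * x, funext fun d => ?_⟩
    rw [Pi.smul_apply, smul_eq_mul, mul_assoc, genTrace_ofCoeff_mul]

variable {m N : ℕ} {α : F}

/-- The codeword `(Tr(xd))_{d ∈ D₃}` of the trace code. -/
noncomputable def codeword (m N : ℕ) (α : F) (k : ℕ) (x : ChainRing F k) :
    definingSet₃ p m N α k → ChainRing (ZMod p) k :=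
  fun d => genTrace p (x * d.1)

theorem codeword_sub (x y : ChainRing F k) :
    codeword p m N α k (x - y) + codeword p m N α k y = codeword p m N α k x := by
  funext d
  simp only [codeword, Pi.add_apply]
  rw [← genTrace_add, ← add_mul, sub_add_cancel]

theorem codeword_zero : codeword p m N α k (0 : ChainRing F k) = 0 := by
  funext d
  simp only [codeword, Pi.zero_apply]
  rw [zero_mul, genTrace_zero]

end Trace

/-! ### The homogeneous weight -/

section Weight

open Classical

variable {p : ℕ} [Fact p.Prime] {k : ℕ}

/-- The weight as a constant plus corrections supported on the minimal ideal, arranged without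
subtraction. The two corrections have equal totals over that ideal. -/
theorem homWeight_add (hk : 2 ≤ k) (y : ChainRing (ZMod p) k) :
    homWeight y + (if y = 0 then p ^ (k - 1) else 0) =
      (p - 1) * p ^ (k - 2) +
        if y ∈ Ideal.span {uElt (ZMod p) k ^ (k - 1)} then p ^ (k - 2) else 0 := by
  have hp : p.Prime := Fact.out
  have hpow : p ^ (k - 1) = (p - 1) * p ^ (k - 2) + p ^ (k - 2) := by
    rw [← Nat.succ_mul, Nat.succ_eq_add_one, Nat.sub_add_cancel hp.one_le, ← pow_succ']
    congr 1
    omega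
  unfold homWeight
  by_cases h0 : y = 0
  · subst h0
    rw [if_pos rfl, if_pos rfl, if_pos (Ideal.zero_mem _), hpow, zero_add]
  · by_cases h1 : y ∈ Ideal.span {uElt (ZMod p) k ^ (k - 1)} <;> simp [h0, h1, hpow]

theorem homWeight_zero : homWeight (0 : ChainRing (ZMod p) k) = 0 := if_pos rfl

theorem eq_zero_iff_uCoeff {K : Type*} [Field K] (hk : 2 ≤ k) (y : ChainRing K k) :
    y = 0 ↔ (∀ i < k - 1, uCoeff y i = 0) ∧ uCoeff y (k - 1) = 0 := by
  constructor
  · rintro rfl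
    exact ⟨fun i _ => uCoeff_zero i, uCoeff_zero _⟩
  · rintro ⟨h1, h2⟩
    refine uCoeff_ext fun i hi => ?_
    rw [uCoeff_zero]
    rcases (show i < k - 1 ∨ i = k - 1 by omega) with h | rfl
    · exact h1 i h
    · exact h2

end Weight

/-! ### Weights of individual codewords -/

section CodewordWeight

open Finset Classical

variable (p : ℕ) [Fact p.Prime] {F : Type*} [Field F] [Fintype F] {k : ℕ}

/-- Finiteness of the chain ring over a finite field, as data. -/
noncomputable instance fintypeChainRing : Fintype (ChainRing F k) := Fintype.ofFinite _

theorem card_filter_uCoeff_zero (hk : 2 ≤ k) (P : F → Prop) :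
    #{d : ChainRing F k | P (uCoeff d 0)} = Fintype.card F ^ (k - 1) * #{y : F | P y} := by
  have hV : Fintype.card (ChainRing F k) = Fintype.card F ^ k := by
    rw [Fintype.card_of_bijective (bijective_uCoeff (F := F) (k := k))]
    simp
  have hfib : ∀ y : F, #{d : ChainRing F k | uCoeff d 0 = y} =
      #{d : ChainRing F k | uCoeff d 0 = 0} := by
    intro y
    refine card_equiv (Equiv.subRight (uMonomial k 0 y)) fun d => ?_
    have h : uCoeff (d - uMonomial k 0 y) 0 + y = uCoeff d 0 := by
      conv_rhs => rw [← sub_add_cancel d (uMonomial k 0 y), uCoeff_add,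
        uCoeff_uMonomial _ _ (by omega), if_pos rfl]
    simp only [mem_filter, mem_univ, true_and, Equiv.subRight_apply]
    rw [← h]
    simp
  have hP : ∀ Q : F → Prop, #{d : ChainRing F k | Q (uCoeff d 0)} =
      #{y : F | Q y} * #{d : ChainRing F k | uCoeff d 0 = 0} := by
    intro Q
    rw [card_eq_sum_card_fiberwise (f := fun d => uCoeff d 0) (t := ({y | Q y} : Finset F))
      (fun d hd => by simpa using hd), sum_const_nat]
    intro y hy
    rw [← hfib y]
    congr 1
    ext d
    simp only [mem_filter, mem_univ, true_and, and_iff_right_iff_imp] at hy ⊢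
    rintro rfl
    exact hy
  have h0 := hP fun _ => True
  simp only [filter_true, card_univ, hV] at h0
  have hfib0 : #{d : ChainRing F k | uCoeff d 0 = 0} = Fintype.card F ^ (k - 1) := by
    apply Nat.eq_of_mul_eq_mul_left (Fintype.card_pos (α := F))
    rw [← h0, ← pow_succ']
    congr 1
    omega
  rw [hP, hfib0, mul_comm]

variable [Algebra (ZMod p) F] {m N : ℕ} {α : F}

theorem wordWeight_codeword (x : ChainRing F k) :
    wordWeight (codeword p m N α k x) =
      ∑ d ∈ ({d | uCoeff d 0 ∈ baseSet p m N α} : Finset (ChainRing F k)),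
        homWeight (genTrace p (x * d)) := by
  rw [wordWeight, finsum_eq_sum_of_fintype]
  exact (sum_subtype _ (by simp [definingSet₃]) (fun d => homWeight (genTrace p (x * d)))).symm

theorem wordWeight_codeword_of_mem (hk : 2 ≤ k) {x : ChainRing F k}
    (hx : ∀ i < k - 1, uCoeff x i = 0) :
    wordWeight (codeword p m N α k x) = p ^ (k - 1) * (Fintype.card F ^ (k - 1) *
      #{y : F | y ∈ baseSet p m N α ∧ Algebra.trace (ZMod p) F (uCoeff x (k - 1) * y) ≠ 0}) := by
  have hp : p.Prime := Fact.out
  rw [wordWeight_codeword]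
  have hcoeff : ∀ (d : ChainRing F k) (i : ℕ), i < k → uCoeff (genTrace p (x * d)) i =
      if i = k - 1 then Algebra.trace (ZMod p) F (uCoeff x (k - 1) * uCoeff d 0) else 0 := by
    intro d i hi
    rw [uCoeff_genTrace p _ hi, mul_comm x, eq_uMonomial hx, uCoeff_mul_uMonomial _ _ _ hi,
      uCoeff_uMonomial _ _ (by omega), if_pos rfl]
    by_cases h : i = k - 1
    · subst h
      rw [if_pos le_rfl, if_pos rfl, Nat.sub_self, mul_comm]
    · rw [if_neg (by omega), if_neg h, map_zero]
  have hw : ∀ d : ChainRing F k, homWeight (genTrace p (x * d)) =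
      if Algebra.trace (ZMod p) F (uCoeff x (k - 1) * uCoeff d 0) ≠ 0 then p ^ (k - 1) else 0 := by
    intro d
    have hmem : genTrace p (x * d) ∈ Ideal.span {uElt (ZMod p) k ^ (k - 1)} := by
      rw [mem_span_uElt_pow (by omega)]
      intro i hi
      rw [hcoeff d i (by omega), if_neg (by omega)]
    have hzero : genTrace p (x * d) = 0 ↔
        Algebra.trace (ZMod p) F (uCoeff x (k - 1) * uCoeff d 0) = 0 := by
      rw [eq_zero_iff_uCoeff hk, hcoeff d (k - 1) (by omega), if_pos rfl]
      exact and_iff_right ((mem_span_uElt_pow (by omega) _).mp hmem)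
    simp only [homWeight, hzero, hmem, if_true, ne_eq, ite_not]
  simp only [hw]
  rw [← sum_filter, sum_const, smul_eq_mul, mul_comm, filter_filter]
  refine congrArg _ ?_
  convert card_filter_uCoeff_zero hk fun y =>
    y ∈ baseSet p m N α ∧ Algebra.trace (ZMod p) F (uCoeff x (k - 1) * y) ≠ 0

/-- The top coefficient of `Tr(xd)` is equidistributed over `𝔽_p` among the `d` for which `Tr(xd)`
lies in the minimal ideal. Hence that ideal is hit `p` times as often as `0`, and the corrections in
`homWeight_add` cancel. -/
theorem wordWeight_codeword_of_not_mem (hk : 2 ≤ k) {x : ChainRing F k}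
    (hx : ¬ ∀ i < k - 1, uCoeff x i = 0) :
    wordWeight (codeword p m N α k x) = (p - 1) * p ^ (k - 2) *
      (Fintype.card F ^ (k - 1) * #{y : F | y ∈ baseSet p m N α}) := by
  have hp : p.Prime := Fact.out
  push Not at hx
  have hj := Nat.find_spec hx
  have hmin : ∀ i < Nat.find hx, uCoeff x i = 0 := fun i hi => by
    have := Nat.find_min hx hi
    push Not at this
    exact this (by omega)
  obtain ⟨hjk, hxj⟩ := hj
  set j := Nat.find hx
  rw [wordWeight_codeword, ← card_filter_uCoeff_zero hk]
  set D : Finset (ChainRing F k) := {d | uCoeff d 0 ∈ baseSet p m N α} with hD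
  set low : ChainRing F k → Prop :=
    fun d => ∀ i < k - 1, Algebra.trace (ZMod p) F (uCoeff (x * d) i) = 0 with hlow
  set top : ChainRing F k → ZMod p :=
    fun d => Algebra.trace (ZMod p) F (uCoeff (x * d) (k - 1)) with htop
  have hmem : ∀ d, genTrace p (x * d) ∈ Ideal.span {uElt (ZMod p) k ^ (k - 1)} ↔ low d := by
    intro d
    rw [mem_span_uElt_pow (by omega)]
    exact forall₂_congr fun i hi => by rw [uCoeff_genTrace p _ (by omega)]
  have hzero : ∀ d, genTrace p (x * d) = 0 ↔ low d ∧ top d = 0 := by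
    intro d
    rw [eq_zero_iff_uCoeff hk, uCoeff_genTrace p _ (by omega)]
    refine and_congr (forall₂_congr fun i hi => by rw [uCoeff_genTrace p _ (by omega)]) Iff.rfl
  have htrans : ∀ c : ZMod p, #{d ∈ D | low d ∧ top d = c} = #{d ∈ D | low d ∧ top d = 0} := by
    intro c
    obtain ⟨y, hy⟩ := trace_zmod_surjective (F := F) p c
    -- Since `x` starts at `x_j u^j`, the product `x * g` is `y u^(k-1)`. As `j < k - 1`, the
    -- constant coefficient of `d` is untouched, so the shift preserves `D`.
    set g : ChainRing F k := uMonomial k (k - 1 - j) ((uCoeff x j)⁻¹ * y) with hg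
    have hg0 : ∀ d : ChainRing F k, uCoeff (d + g) 0 = uCoeff d 0 := by
      intro d
      rw [uCoeff_add, hg, uCoeff_uMonomial _ _ (by omega), if_neg (by omega), add_zero]
    have hglow : ∀ (d : ChainRing F k), ∀ i < k - 1, uCoeff (x * (d + g)) i = uCoeff (x * d) i := by
      intro d i hi
      rw [mul_add, uCoeff_add, hg, uCoeff_mul_uMonomial _ _ _ (by omega)]
      split_ifs with h
      · rw [hmin _ (by omega), zero_mul, add_zero]
      · rw [add_zero]
    have hgtop : ∀ d : ChainRing F k, top (d + g) = top d + c := by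
      intro d
      simp only [htop]
      rw [mul_add, uCoeff_add, hg, uCoeff_mul_uMonomial _ _ _ (by omega), if_pos (by omega),
        show k - 1 - (k - 1 - j) = j by omega, mul_inv_cancel_left₀ hxj, map_add, hy]
    refine (card_equiv (Equiv.addRight g) fun d => ?_).symm
    simp only [mem_filter, mem_univ, true_and, Equiv.coe_addRight, hD, hlow, hg0]
    refine and_congr Iff.rfl (and_congr ?_ ?_)
    · exact forall₂_congr fun i hi => by rw [hglow d i hi]
    · rw [hgtop]; simp
  have hU : #{d ∈ D | low d} = p * #{d ∈ D | low d ∧ top d = 0} := by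
    rw [card_eq_sum_card_fiberwise (f := top) (t := (univ : Finset (ZMod p)))
      (fun d _ => by simp)]
    simp only [filter_filter, htrans]
    simp [ZMod.card]
  have hsum := sum_congr (rfl : D = D) fun d _ => homWeight_add hk (genTrace p (x * d))
  rw [sum_add_distrib, sum_add_distrib, sum_const, smul_eq_mul] at hsum
  simp only [hmem, hzero] at hsum
  rw [← sum_filter, ← sum_filter, sum_const, sum_const, smul_eq_mul, smul_eq_mul, hU] at hsum
  have hpow : p ^ (k - 1) = p * p ^ (k - 2) := by
    rw [← pow_succ']
    congr 1
    omega
  rw [hpow, show p * #{d ∈ D | low d ∧ top d = 0} * p ^ (k - 2) =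
    #{d ∈ D | low d ∧ top d = 0} * (p * p ^ (k - 2)) by ring] at hsum
  rw [Nat.add_right_cancel hsum, mul_comm]

end CodewordWeight

/-! ### Counting codewords and the weight distribution -/

section Distribution

open Finset Classical

theorem card_filter_uCoeff_top_mem {F : Type*} [Field F] [Fintype F] {k : ℕ} (hk : 2 ≤ k)
    (T : Finset F) :
    #{x : ChainRing F k | (∀ i < k - 1, uCoeff x i = 0) ∧ uCoeff x (k - 1) ∈ T} = #T := by
  have htop : ∀ y : F, uCoeff (uMonomial k (k - 1) y) (k - 1) = y := fun y => by
    rw [uCoeff_uMonomial _ _ (by omega), if_pos rfl]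
  refine card_nbij' (fun x => uCoeff x (k - 1)) (fun y => uMonomial k (k - 1) y) ?_ ?_ ?_ ?_
  · intro x hx
    simp only [coe_filter, mem_univ, true_and, Set.mem_ofPred_eq] at hx
    exact hx.2
  · intro y hy
    simp only [coe_filter, mem_univ, true_and, Set.mem_ofPred_eq, htop]
    exact ⟨fun i hi => by rw [uCoeff_uMonomial _ _ (by omega), if_neg (by omega)], hy⟩
  · intro x hx
    simp only [coe_filter, mem_univ, true_and, Set.mem_ofPred_eq] at hx
    exact (eq_uMonomial hx.1).symm
  · intro y _
    exact htop y

/-- Here `r = p^(m/2)` and `ε = (-1)^t`. The first numerator is `r(r + ε(n-1)) > 0`; the differences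
reduce to `ε(n-1)r ≠ -1`, `nr ≠ 0` and `εr ≠ 1`. -/
theorem distributionB_weights_pairwise_ne {A n q r ε : ℚ} (hA : 0 < A) (hn : 2 < n) (hr : 2 ≤ r)
    (hq : q = r * r) (hε : ε = 1 ∨ ε = -1) (hpos : 0 < r + ε * (n - 1)) :
    A * ((q + ε * (n - 1) * r) / n) ≠ 0 ∧ A * ((q - 1) / n) ≠ 0 ∧ A * ((q - ε * r) / n) ≠ 0 ∧
      A * ((q + ε * (n - 1) * r) / n) ≠ A * ((q - 1) / n) ∧
      A * ((q + ε * (n - 1) * r) / n) ≠ A * ((q - ε * r) / n) ∧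
      A * ((q - 1) / n) ≠ A * ((q - ε * r) / n) := by
  have hn0 : n ≠ 0 := by linarith
  have hcancel : ∀ x y : ℚ, x ≠ y → A * (x / n) ≠ A * (y / n) := fun x y hxy h =>
    hxy ((div_left_inj' hn0).mp (mul_left_cancel₀ hA.ne' h))
  have hzero : ∀ x : ℚ, x ≠ 0 → A * (x / n) ≠ 0 := fun x hx =>
    mul_ne_zero hA.ne' (div_ne_zero hx hn0)
  have hnr : 4 < n * r := by nlinarith
  have hrr : 2 * r ≤ r * r := by nlinarith
  have hpos' : 0 < r * (r + ε * (n - 1)) := mul_pos (by linarith) hpos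
  subst hq
  refine ⟨hzero _ ?_, hzero _ ?_, hzero _ ?_, hcancel _ _ ?_, hcancel _ _ ?_, hcancel _ _ ?_⟩ <;>
    rcases hε with rfl | rfl <;> intro h <;> nlinarith

theorem distributionA_eq_distributionB (p m k n : ℕ) {t : ℕ} (ht : Odd t) :
    distributionA p m k n = distributionB p m k n t := by
  unfold distributionA distributionB
  simp only [ht.neg_one_pow, neg_mul, one_mul, sub_neg_eq_add, ← sub_eq_add_neg]

variable (p : ℕ) [Fact p.Prime] {F : Type*} [Field F] [Fintype F] [Algebra (ZMod p) F]
  {m N k k' t : ℕ} {α : F}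

/-- The weight of a nonzero codeword depends only on whether its parameter lies in the minimal
ideal `(u^(k-1))` and, if so, on a class of size `(p^m-1)/N'_2` for its top coefficient. -/
theorem exists_wordWeight_codeword (hk : 2 ≤ k) (hm0 : m ≠ 0) (hF : Fintype.card F = p ^ m)
    (hα : IsPrimitiveRoot α (p ^ m - 1)) (hN : 0 < N) (hk' : 0 < k')
    (hsemi : gcdN p m N ∣ p ^ k' + 1) (ht : m = 2 * k' * t) :
    ∃ S : Finset F, (0 : F) ∉ S ∧ gcdN p m N * #S = p ^ m - 1 ∧ ∀ x : ChainRing F k, x ≠ 0 →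
      (wordWeight (codeword p m N α k x) : ℚ) =
        if ∀ i < k - 1, uCoeff x i = 0 then
          if uCoeff x (k - 1) ∈ S then
            (p : ℚ) ^ ((k - 1) * (m + 1) - 1) * (((p : ℚ) ^ m +
              (-1) ^ t * ((gcdN p m N : ℚ) - 1) * (p : ℚ) ^ (m / 2)) / gcdN p m N)
          else
            (p : ℚ) ^ ((k - 1) * (m + 1) - 1) *
              (((p : ℚ) ^ m - (-1) ^ t * (p : ℚ) ^ (m / 2)) / gcdN p m N)
        else (p : ℚ) ^ ((k - 1) * (m + 1) - 1) * (((p : ℚ) ^ m - 1) / gcdN p m N) := by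
  have hp : p.Prime := Fact.out
  obtain ⟨S, hS0, hScard, hS⟩ := exists_card_baseSet_filter p hk' ht hm0 hF hα hN hsemi
  obtain ⟨M, hM0, hM, hlcm, -⟩ := exists_eq_gcdN_mul p hm0 hN
  obtain ⟨-, -, hcard⟩ := image_pow_baseSet p hm0 hF hα hN
  rw [hlcm] at hcard
  set n := gcdN p m N with hn
  have hn0 : (n : ℚ) ≠ 0 := by
    exact_mod_cast (Nat.gcd_pos_of_pos_left _ hN : 0 < n).ne'
  obtain ⟨k, rfl⟩ : ∃ l, k = l + 2 := ⟨k - 2, by omega⟩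
  -- The factors `p^(k-1)` and `q^(k-1)` give exponent `(k-1)(m+1)`; the `-1` comes from the `p`
  -- multiplying the count over `D'`, or, outside the ideal, from `p^(k-2)`.
  have hexp : (k + 2 - 1) * (m + 1) - 1 = k + m * (k + 1) := by
    rw [show k + 2 - 1 = k + 1 by omega, show (k + 1) * (m + 1) = k + m * (k + 1) + 1 by ring,
      Nat.add_sub_cancel]
  refine ⟨S, hS0, hScard, fun x hx => ?_⟩
  rw [hexp]
  split_ifs with hI hxS
  · have hx0 : uCoeff x (k + 2 - 1) ≠ 0 := fun h => hx ((eq_zero_iff_uCoeff hk x).mpr ⟨hI, h⟩)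
    have := hS _ hx0
    rw [if_pos hxS] at this
    have hq := congrArg (Int.cast : ℤ → ℚ) this
    rw [wordWeight_codeword_of_mem p hk hI, hF]
    push_cast at hq ⊢
    field_simp
    linear_combination (p : ℚ) ^ (k + m * (k + 1)) * hq
  · have hx0 : uCoeff x (k + 2 - 1) ≠ 0 := fun h => hx ((eq_zero_iff_uCoeff hk x).mpr ⟨hI, h⟩)
    have := hS _ hx0
    rw [if_neg hxS] at this
    have hq := congrArg (Int.cast : ℤ → ℚ) this
    rw [wordWeight_codeword_of_mem p hk hI, hF]
    push_cast at hq ⊢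
    field_simp
    linear_combination (p : ℚ) ^ (k + m * (k + 1)) * hq
  · rw [wordWeight_codeword_of_not_mem p hk hI, hF, hcard]
    have hq : (p : ℚ) ^ m - 1 = (p - 1) * (n * M) := by
      have := congrArg (Nat.cast : ℕ → ℚ) hM
      rw [Nat.cast_sub (Nat.one_le_pow _ _ hp.pos)] at this
      push_cast [Nat.cast_sub hp.one_le] at this
      exact this
    rw [hq]
    push_cast [Nat.cast_sub hp.one_le]
    field_simp
    ring

theorem wordWeight_zero {ι : Type*} [Finite ι] :
    wordWeight (0 : ι → ChainRing (ZMod p) k) = 0 := by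
  simp [wordWeight, homWeight_zero]

theorem hasWeightDistribution_traceCode (hk : 2 ≤ k) (hF : Fintype.card F = p ^ m)
    (hα : IsPrimitiveRoot α (p ^ m - 1)) (hN : 0 < N) (hN₂ : 2 < gcdN p m N) (hk' : 0 < k')
    (hsemi : gcdN p m N ∣ p ^ k' + 1) (hm : Even m) (ht : m = 2 * k' * t)
    (hpos : 0 < (p : ℤ) ^ (m / 2) + (-1) ^ t * ((gcdN p m N : ℤ) - 1)) :
    IsLinearCode (traceCode p (definingSet₃ p m N α k)) ∧
      IsThreeWeight (traceCode p (definingSet₃ p m N α k)) ∧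
      HasWeightDistribution (traceCode p (definingSet₃ p m N α k))
        (distributionB p m k (gcdN p m N) t) := by
  have hp : p.Prime := Fact.out
  have hm0 : m ≠ 0 := by
    rintro rfl
    have := Fintype.one_lt_card (α := F)
    rw [hF, pow_zero] at this
    exact this.false
  obtain ⟨S, hS0, hScard, hW⟩ := exists_wordWeight_codeword p hk hm0 hF hα hN hk' hsemi ht
  have hq1 : 1 < p ^ m := Nat.one_lt_pow hm0 hp.one_lt
  obtain ⟨h1, h2, h3, h12, h13, h23⟩ := distributionB_weights_pairwise_ne
    (A := (p : ℚ) ^ ((k - 1) * (m + 1) - 1)) (n := gcdN p m N) (q := (p : ℚ) ^ m)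
    (r := (p : ℚ) ^ (m / 2)) (ε := (-1) ^ t)
    (pow_pos (by exact_mod_cast hp.pos) _) (by exact_mod_cast hN₂)
    (by
      have hm2 : m / 2 ≠ 0 := by obtain ⟨c, rfl⟩ := hm; omega
      exact_mod_cast hp.two_le.trans (Nat.le_self_pow hm2 p))
    (by rw [← pow_add]; congr 1; obtain ⟨c, rfl⟩ := hm; omega)
    (neg_one_pow_eq_or ℚ t) (by exact_mod_cast hpos)
  have hdist : distributionB p m k (gcdN p m N) t =
      [(0, 1), (_, ((p : ℚ) ^ m - 1) / gcdN p m N), (_, (p : ℚ) ^ (k * m) - (p : ℚ) ^ m),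
        (_, ((gcdN p m N : ℚ) - 1) * ((p : ℚ) ^ m - 1) / gcdN p m N)] := rfl
  set n := gcdN p m N with hn
  set w₁ : ℚ := (p : ℚ) ^ ((k - 1) * (m + 1) - 1) *
    (((p : ℚ) ^ m + (-1) ^ t * ((n : ℚ) - 1) * (p : ℚ) ^ (m / 2)) / n) with hw₁
  set w₂ : ℚ := (p : ℚ) ^ ((k - 1) * (m + 1) - 1) * (((p : ℚ) ^ m - 1) / n) with hw₂
  set w₃ : ℚ := (p : ℚ) ^ ((k - 1) * (m + 1) - 1) *
    (((p : ℚ) ^ m - (-1) ^ t * (p : ℚ) ^ (m / 2)) / n) with hw₃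
  have hn0 : (n : ℚ) ≠ 0 := by exact_mod_cast (by omega : n ≠ 0)
  have hSQ : (n : ℚ) * #S = (p : ℚ) ^ m - 1 := by
    have := congrArg (Nat.cast : ℕ → ℚ) hScard
    rw [Nat.cast_sub hq1.le] at this
    exact_mod_cast this
  have hW0 : wordWeight (codeword p m N α k (0 : ChainRing F k)) = 0 := by
    rw [codeword_zero, wordWeight_zero]
  have hne : ∀ x : ChainRing F k, x ≠ 0 → wordWeight (codeword p m N α k x) ≠ 0 := by
    intro x hx h
    have := hW x hx
    rw [h, Nat.cast_zero] at this
    split_ifs at this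
    exacts [h1 this.symm, h3 this.symm, h2 this.symm]
  -- Nonzero parameters give nonzero weight, so codewords may be counted by their parameters.
  have hinj : Function.Injective (codeword p m N α k) := by
    intro x y hxy
    by_contra hne'
    have := codeword_sub p (m := m) (N := N) (α := α) x y
    rw [hxy, add_eq_right] at this
    exact hne _ (sub_ne_zero.mpr hne') (by rw [this, wordWeight_zero])
  have hcode : traceCode p (definingSet₃ p m N α k) = Set.range (codeword p m N α k) := by
    ext c
    exact exists_congr fun x => eq_comm
  have hne0 : ∀ x : ChainRing F k, codeword p m N α k x ≠ 0 ↔ x ≠ 0 := fun x => by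
    rw [← codeword_zero p (m := m) (N := N) (α := α) (k := k)]
    exact hinj.ne_iff
  have hncard : ∀ w : ℚ, ({c | c ∈ traceCode p (definingSet₃ p m N α k) ∧
      (wordWeight c : ℚ) = w}).ncard =
        #{x : ChainRing F k | (wordWeight (codeword p m N α k x) : ℚ) = w} := by
    intro w
    rw [← Set.ncard_coe_finset, ← Set.ncard_image_of_injective _ hinj, hcode]
    congr 1
    ext c
    simp only [Set.mem_ofPred_eq, Set.mem_range, coe_filter, mem_univ, true_and, Set.mem_image]
    constructor
    · rintro ⟨⟨x, rfl⟩, hx⟩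
      exact ⟨x, hx, rfl⟩
    · rintro ⟨x, hx, rfl⟩
      exact ⟨⟨x, rfl⟩, hx⟩
  have htop0 : ∀ x : ChainRing F k, x ≠ 0 → (∀ i < k - 1, uCoeff x i = 0) →
      uCoeff x (k - 1) ≠ 0 := fun x hx hI h => hx ((eq_zero_iff_uCoeff hk x).mpr ⟨hI, h⟩)
  have hiff₁ : ∀ x : ChainRing F k, (wordWeight (codeword p m N α k x) : ℚ) = w₁ ↔
      (∀ i < k - 1, uCoeff x i = 0) ∧ uCoeff x (k - 1) ∈ S := by
    intro x
    by_cases hx : x = 0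
    · subst hx
      rw [hW0, Nat.cast_zero, uCoeff_zero]
      exact iff_of_false h1.symm fun h => hS0 h.2
    · rw [hW x hx]
      split_ifs with hI hxS
      · exact iff_of_true rfl ⟨hI, hxS⟩
      · exact iff_of_false h13.symm fun h => hxS h.2
      · exact iff_of_false h12.symm fun h => hI h.1
  have hiff₂ : ∀ x : ChainRing F k, (wordWeight (codeword p m N α k x) : ℚ) = w₂ ↔
      ¬ ∀ i < k - 1, uCoeff x i = 0 := by
    intro x
    by_cases hx : x = 0
    · subst hx
      rw [hW0, Nat.cast_zero]
      exact iff_of_false h2.symm fun h => h fun i _ => uCoeff_zero i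
    · rw [hW x hx]
      split_ifs with hI hxS
      · exact iff_of_false h12 fun h => h hI
      · exact iff_of_false h23.symm fun h => h hI
      · exact iff_of_true rfl hI
  have hiff₃ : ∀ x : ChainRing F k, (wordWeight (codeword p m N α k x) : ℚ) = w₃ ↔
      (∀ i < k - 1, uCoeff x i = 0) ∧ uCoeff x (k - 1) ∉ insert 0 S := by
    intro x
    by_cases hx : x = 0
    · subst hx
      rw [hW0, Nat.cast_zero, uCoeff_zero]
      exact iff_of_false h3.symm fun h => h.2 (mem_insert_self _ _)
    · rw [hW x hx]
      split_ifs with hI hxS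
      · exact iff_of_false h13 fun h => h.2 (mem_insert_of_mem hxS)
      · refine iff_of_true rfl ⟨hI, fun h => ?_⟩
        rcases mem_insert.mp h with h | h
        exacts [htop0 x hx hI h, hxS h]
      · exact iff_of_false h23 fun h => hI h.1
  have hcount₁ : #{x : ChainRing F k | (wordWeight (codeword p m N α k x) : ℚ) = w₁} = #S := by
    simp only [hiff₁]
    exact card_filter_uCoeff_top_mem hk S
  have hcount₂ : (#{x : ChainRing F k | (wordWeight (codeword p m N α k x) : ℚ) = w₂}) + p ^ m =
      p ^ (k * m) := by
    simp only [hiff₂]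
    have h := card_filter_add_card_filter_not (s := (univ : Finset (ChainRing F k)))
      (fun x => ∀ i < k - 1, uCoeff x i = 0)
    have h' := card_filter_uCoeff_top_mem (F := F) hk univ
    simp only [mem_univ, and_true, card_univ, hF] at h'
    rw [h', card_univ, Fintype.card_of_bijective (bijective_uCoeff (F := F) (k := k)),
      Fintype.card_pi_const, hF, ← pow_mul, mul_comm m] at h
    omega
  have hcount₃ : (#{x : ChainRing F k | (wordWeight (codeword p m N α k x) : ℚ) = w₃}) +
      (#S + 1) = p ^ m := by
    simp only [hiff₃]
    have h := card_filter_uCoeff_top_mem (F := F) hk (insert 0 S)ᶜ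
    simp only [mem_compl] at h
    rw [h, ← card_insert_of_notMem hS0, card_compl_add_card, hF]
  have hSpos : 0 < #S := Nat.pos_of_ne_zero fun h => by rw [h] at hScard; omega
  -- Since `n > 2`, some nonzero top coefficient lies outside `S`, so the third weight does occur.
  have hScard' : #S + 1 < p ^ m := by nlinarith [Nat.sub_add_cancel hq1.le]
  refine ⟨isLinearCode_traceCode p _, ⟨?_, ?_⟩, ?_, ?_, ?_⟩
  · obtain ⟨x₁, hx₁⟩ := card_pos.mp (hcount₁ ▸ hSpos)
    obtain ⟨x₃, hx₃⟩ := card_pos.mp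
      (by omega : 0 < #{x : ChainRing F k | (wordWeight (codeword p m N α k x) : ℚ) = w₃})
    have hx₂ : (wordWeight (codeword p m N α k (uMonomial k 0 (1 : F))) : ℚ) = w₂ := by
      rw [hiff₂]
      intro h
      have := h 0 (by omega)
      rw [uCoeff_uMonomial _ _ (by omega), if_pos rfl] at this
      exact one_ne_zero this
    simp only [mem_filter, mem_univ, true_and] at hx₁ hx₃
    have hcast : ∀ {a b : ℕ} {u v : ℚ}, (a : ℚ) = u → (b : ℚ) = v → u ≠ v → a ≠ b := by
      rintro a b u v rfl rfl h rfl
      exact h rfl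
    refine Set.ncard_eq_three.mpr ⟨_, _, _, hcast hx₁ hx₂ h12, hcast hx₁ hx₃ h13,
      hcast hx₂ hx₃ h23, ?_⟩
    have hnz : ∀ {x : ChainRing F k} {u : ℚ},
        (wordWeight (codeword p m N α k x) : ℚ) = u → u ≠ 0 → x ≠ 0 := by
      rintro x u hu hu0 rfl
      rw [hW0, Nat.cast_zero] at hu
      exact hu0 hu.symm
    ext w
    simp only [hcode, Set.mem_ofPred_eq, Set.mem_range, Set.mem_insert_iff,
      Set.mem_singleton_iff]
    constructor
    · rintro ⟨_, ⟨x, rfl⟩, hx, rfl⟩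
      have := hW x ((hne0 x).mp hx)
      split_ifs at this
      · left; exact_mod_cast this.trans hx₁.symm
      · right; right; exact_mod_cast this.trans hx₃.symm
      · right; left; exact_mod_cast this.trans hx₂.symm
    · rintro (rfl | rfl | rfl)
      exacts [⟨_, ⟨_, rfl⟩, (hne0 _).mpr (hnz hx₁ h1), rfl⟩,
        ⟨_, ⟨_, rfl⟩, (hne0 _).mpr (hnz hx₂ h2), rfl⟩,
        ⟨_, ⟨_, rfl⟩, (hne0 _).mpr (hnz hx₃ h3), rfl⟩]
  · rw [hcode]
    rintro _ ⟨x, rfl⟩ hx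
    exact hne x ((hne0 x).mp hx)
  · rw [hdist]
    simp only [List.map_cons, List.map_nil, List.nodup_cons, List.mem_cons, List.not_mem_nil,
      or_false, not_or, not_false_iff, List.nodup_nil, and_true]
    exact ⟨⟨h1.symm, h2.symm, h3.symm⟩, ⟨h12, h13⟩, h23⟩
  · rw [hcode, hdist]
    rintro _ ⟨x, rfl⟩
    simp only [List.map_cons, List.map_nil, List.mem_cons, List.not_mem_nil, or_false]
    by_cases hx : x = 0
    · left
      rw [hx, hW0, Nat.cast_zero]
    · have := hW x hx
      split_ifs at this
      exacts [Or.inr (Or.inl this), Or.inr (Or.inr (Or.inr this)), Or.inr (Or.inr (Or.inl this))]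
  · intro wf hwf
    rw [hncard]
    rw [hdist] at hwf
    simp only [List.mem_cons, List.not_mem_nil, or_false] at hwf
    rcases hwf with rfl | rfl | rfl | rfl
    · have : ({x : ChainRing F k | (wordWeight (codeword p m N α k x) : ℚ) = 0} :
          Finset (ChainRing F k)) = {0} := by
        ext x
        simp only [mem_filter, mem_univ, true_and, mem_singleton, Nat.cast_eq_zero]
        refine ⟨fun h => by_contra fun hx => hne x hx h, ?_⟩
        rintro rfl
        exact hW0
      simp only [this, card_singleton, Nat.cast_one]
    · rw [hcount₁, ← hSQ, mul_div_cancel_left₀ _ hn0]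
    · exact eq_sub_of_add_eq (by exact_mod_cast hcount₂)
    · have h := congrArg (Nat.cast : ℕ → ℚ) hcount₃
      push_cast at h
      rw [eq_div_iff hn0]
      linear_combination (n : ℚ) * h - hSQ

end Distribution

end FewWeights

theorem theorem6 (p : ℕ) [Fact p.Prime] (m k : ℕ) (hk : 2 ≤ k)
    (F : Type*) [Field F] [Finite F] [Algebra (ZMod p) F] (hF : Nat.card F = p ^ m)
    (α : F) (hα : IsPrimitiveRoot α (p ^ m - 1))
    (N : ℕ) (hN : 0 < N) (hdvd : N ∣ p ^ m - 1)
    (hN₂ : 2 < FewWeights.gcdN p m N)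
    (k' : ℕ) (hk' : 0 < k')
    (hsemi : (p : ℤ) ^ k' ≡ -1 [ZMOD (FewWeights.gcdN p m N : ℤ)])
    (hm : Even m) (t : ℕ) (ht : m = 2 * k' * t) :
    ((Even (FewWeights.gcdN p m N) ∧ Odd p ∧ Odd t ∧
        Odd ((p ^ k' + 1) / FewWeights.gcdN p m N)) →
      FewWeights.gcdN p m N < p ^ (m / 2) + 1 →
        FewWeights.IsLinearCode (FewWeights.traceCode p (FewWeights.definingSet₃ p m N α k)) ∧
        FewWeights.IsThreeWeight (FewWeights.traceCode p (FewWeights.definingSet₃ p m N α k)) ∧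
        FewWeights.HasWeightDistribution
          (FewWeights.traceCode p (FewWeights.definingSet₃ p m N α k))
          (FewWeights.distributionA p m k (FewWeights.gcdN p m N))) ∧
    (¬ (Even (FewWeights.gcdN p m N) ∧ Odd p ∧ Odd t ∧
        Odd ((p ^ k' + 1) / FewWeights.gcdN p m N)) →
      0 < (p : ℤ) ^ (m / 2) + (-1) ^ t * ((FewWeights.gcdN p m N : ℤ) - 1) →
        FewWeights.IsLinearCode (FewWeights.traceCode p (FewWeights.definingSet₃ p m N α k)) ∧
        FewWeights.IsThreeWeight (FewWeights.traceCode p (FewWeights.definingSet₃ p m N α k)) ∧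
        FewWeights.HasWeightDistribution
          (FewWeights.traceCode p (FewWeights.definingSet₃ p m N α k))
          (FewWeights.distributionB p m k (FewWeights.gcdN p m N) t)) := by
  have := Fintype.ofFinite F
  rw [Nat.card_eq_fintype_card] at hF
  have hdvd' : FewWeights.gcdN p m N ∣ p ^ k' + 1 := by
    have := hsemi.symm.dvd
    rw [sub_neg_eq_add] at this
    exact_mod_cast this
  have main := FewWeights.hasWeightDistribution_traceCode p hk hF hα hN hN₂ hk' hdvd' hm ht
  -- In the first case `t` is odd, so its table is the general one with `(-1)^t = -1`. The parity
  -- conditions only influence which coset is exceptional, not its size.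
  refine ⟨fun h hlt => ?_, fun _ hpos => main hpos⟩
  rw [FewWeights.distributionA_eq_distributionB p m k _ h.2.2.1]
  refine main ?_
  rw [h.2.2.1.neg_one_pow]
  have : (FewWeights.gcdN p m N : ℤ) < (p : ℤ) ^ (m / 2) + 1 := by exact_mod_cast hlt
  linarith
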